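/- **Theorem.** Let $(X,d,\mu)$ be a metric measure space, i.e. $(X,d)$ is a compact metric space and $\mu$ is a Borel probability measure on $X$. Put $K_A(x,s)=-\tfrac12 d(x,s)^2$ and $$K_B(x,s)=K_A(x,s)-\int_X K_A(w,s)\,\mu(dw)-\int_X K_A(x,z)\,\mu(dz)+\int_X\!\int_X K_A(w,z)\,\mu(dw)\,\mu(dz).$$ For $K\in L^2(X\times X,\mu\otimes\mu)$ let $T_K$ be the integral operator $(T_K\phi)(x)=\int_X K(x,s)\phi(s)\,\mu(ds)$ on $L^2(X,\mu)$. Let $\hat\lambda_1\ge\hat\lambda_2\ge\dots\ge 0$ be the positive eigenvalues of $T_{K_B}$ listed with multiplicity (continued by zeros if there are only finitely many), and let $\phi_i$ (for $\hat\lambda_i>0$) be corresponding eigenfunctions that form an orthonormal system in $L^2(X,\mu)$. The infinite MDS embeddings are $$f_m(x)=\bigl(\sqrt{\hat\lambda_1}\,\phi_1(x),\dots,\sqrt{\hat\lambda_m}\,\phi_m(x)\bigr)\in\mathbb R^m,\qquad f_\infty(x)=\bigl(\sqrt{\hat\lambda_1}\,\phi_1(x),\sqrt{\hat\lambda_2}\,\phi_2(x),\dots\bigr),$$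 where coordinates with $\hat\lambda_i=0$ are $0$; the second is a map into $\ell^2$ (defined $\mu$-almost everywhere) if $\sum_i\hat\lambda_i\phi_i(x)^2<\infty$ for $\mu$-almost every $x$. For a map $f$ from $X$ to $\mathbb R^m$ or $\ell^2$ that is measurable up to a $\mu$-null set, let $K_{\hat B}(x,s)=\langle f(x)-\bar f,\,f(s)-\bar f\rangle$ be its centered inner product kernel, where $\bar f=\int f\,d\mu$ if $f$ is integrable and $\bar f=0$ otherwise, and set $$\mathrm{Strain}(f)=\int_X\!\int_X\bigl(K_B(x,s)-K_{\hat B}(x,s)\bigr)^2\mu(dx)\,\mu(ds)\in[0,\infty].$$ Then: 1. For every almost everywhere symmetric kernel $K\in L^2(X\times X)$, $$\iint (K_B-K)^2\,d\mu\,d\mu=\|T_{K_B}-T_K\|_{HS}^2=\mathrm{Tr}\bigl((T_{K_B}-T_K)^2\bigr),$$ where the Hilbert–Schmidt norm and the trace are computed in any orthonormal basis of $L^2(X,\mu)$. In particular $\mathrm{Strain}(f)$ is the squared Hilbert–Schmidt norm of $T_{K_B}-T_{K_{\hat B}}$ whenever $K_{\hat B}\in L^2(X\times X)$. 2. For every $m\ge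 0$ and every such map $g:X\to\mathbb R^m$, $\mathrm{Strain}(f_m)\le\mathrm{Strain}(g)$. 3. If $f_\infty$ takes values in $\ell^2$ almost everywhere, then $\mathrm{Strain}(f_\infty)\le\mathrm{Strain}(g)$ for every such map $g:X\to\ell^2$. The condition holds in particular if $\sum_i\hat\lambda_i<\infty$. 4. In all cases the series $\sum_i\hat\lambda_i\phi_i(x)\phi_i(s)$ converges in $L^2(X\times X)$ to a kernel $K$ with $\iint(K_B-K)^2\,d\mu\,d\mu=\inf_g\mathrm{Strain}(g)$, the infimum over all such maps $g:X\to\ell^2$; and if $f_\infty$ takes values in $\ell^2$ almost everywhere, then $K$ is almost everywhere equal to the centered inner product kernel of $f_\infty$. -/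

import Mathlib

open MeasureTheory Filter Topology
open scoped ENNReal RealInnerProductSpace

noncomputable section

namespace InfiniteMDS

/-! ### Hilbert-Schmidt integral operators -/

section IntegralOperator

variable {X : Type*} [MeasurableSpace X] (μ : Measure X) [IsProbabilityMeasure μ]

theorem integrable_kernel_mul {K : X → X → ℝ}
    (hK : MemLp (fun p : X × X => K p.1 p.2) 2 (μ.prod μ)) (φ : Lp ℝ 2 μ) :
    Integrable (fun p : X × X => K p.1 p.2 * φ p.2) (μ.prod μ) :=
  MemLp.integrable_mul (p := 2) (q := 2) hK ((Lp.memLp φ).comp_snd μ)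

theorem eLpNorm_integral_le {K : X → X → ℝ}
    (hK : MemLp (fun p : X × X => K p.1 p.2) 2 (μ.prod μ)) (φ : Lp ℝ 2 μ) :
    eLpNorm (fun x => ∫ s, K x s * φ s ∂μ) 2 μ ≤
      eLpNorm (fun p : X × X => K p.1 p.2) 2 (μ.prod μ) * eLpNorm φ 2 μ := by
  have h2 : ∀ {α : Type _} [MeasurableSpace α] (ν : Measure α) (g : α → ℝ),
      eLpNorm g 2 ν = (∫⁻ a, ‖g a‖ₑ ^ (2 : ℝ) ∂ν) ^ (1 / 2 : ℝ) := by
    intro α _ ν g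
    rw [eLpNorm_eq_lintegral_rpow_enorm_toReal (by norm_num) (by norm_num)]
    norm_num
  have hφ : AEMeasurable (fun s => ‖φ s‖ₑ) μ := (Lp.memLp φ).1.enorm
  have hKm : ∀ᵐ x ∂μ, AEStronglyMeasurable (fun s => K x s) μ := hK.1.prodMk_left
  rw [h2, h2, h2, ← ENNReal.mul_rpow_of_nonneg _ _ (by norm_num)]
  refine ENNReal.rpow_le_rpow ?_ (by norm_num)
  rw [lintegral_prod _ (hK.1.enorm.pow_const _)]
  rw [← lintegral_mul_const'' _ (hK.1.enorm.pow_const _).lintegral_prod_right']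
  refine lintegral_mono_ae ?_
  filter_upwards [hKm] with x hx
  have hpq : (2 : ℝ).HolderConjugate 2 := Real.HolderConjugate.two_two
  have key : ‖∫ s, K x s * φ s ∂μ‖ₑ ≤
      (∫⁻ s, ‖K x s‖ₑ ^ (2 : ℝ) ∂μ) ^ (1 / 2 : ℝ) * (∫⁻ s, ‖φ s‖ₑ ^ (2 : ℝ) ∂μ) ^ (1 / 2 : ℝ) := by
    refine (enorm_integral_le_lintegral_enorm _).trans ?_
    simp only [enorm_mul]
    exact ENNReal.lintegral_mul_le_Lp_mul_Lq μ hpq hx.enorm hφ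
  refine (ENNReal.rpow_le_rpow key (by norm_num : (0 : ℝ) ≤ 2)).trans ?_
  rw [ENNReal.mul_rpow_of_nonneg _ _ (by norm_num), ← ENNReal.rpow_mul, ← ENNReal.rpow_mul]
  norm_num

theorem memLp_integral {K : X → X → ℝ}
    (hK : MemLp (fun p : X × X => K p.1 p.2) 2 (μ.prod μ)) (φ : Lp ℝ 2 μ) :
    MemLp (fun x => ∫ s, K x s * φ s ∂μ) 2 μ :=
  ⟨(integrable_kernel_mul μ hK φ).1.integral_prod_right',
    (eLpNorm_integral_le μ hK φ).trans_lt (ENNReal.mul_lt_top hK.2 (Lp.memLp φ).2)⟩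

/-- The Hilbert-Schmidt integral operator `T_K` on `L²(X, μ)` with kernel `K ∈ L²(X × X, μ ⊗ μ)`:
`(T_K φ)(x) = ∫ K(x, s) φ(s) dμ(s)`. -/
def integralOperator (K : X → X → ℝ)
    (hK : MemLp (fun p : X × X => K p.1 p.2) 2 (μ.prod μ)) : Lp ℝ 2 μ →L[ℝ] Lp ℝ 2 μ :=
  LinearMap.mkContinuous
    { toFun := fun φ => (memLp_integral μ hK φ).toLp (fun x => ∫ s, K x s * φ s ∂μ)
      map_add' := by
        intro φ ψ
        rw [← MemLp.toLp_add]
        refine MemLp.toLp_congr _ _ ?_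
        filter_upwards [(integrable_kernel_mul μ hK φ).prod_right_ae,
          (integrable_kernel_mul μ hK ψ).prod_right_ae] with x h1 h2
        rw [Pi.add_apply, ← integral_add h1 h2]
        refine integral_congr_ae ?_
        filter_upwards [Lp.coeFn_add φ ψ] with s hs
        rw [hs, Pi.add_apply, mul_add]
      map_smul' := by
        intro c φ
        rw [RingHom.id_apply, ← MemLp.toLp_const_smul]
        refine MemLp.toLp_congr _ _ (Eventually.of_forall fun x => ?_)
        simp only [Pi.smul_apply, smul_eq_mul]
        rw [← integral_const_mul]
        refine integral_congr_ae ?_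
        filter_upwards [Lp.coeFn_smul c φ] with s hs
        rw [hs, Pi.smul_apply, smul_eq_mul]
        ring }
    (eLpNorm (fun p : X × X => K p.1 p.2) 2 (μ.prod μ)).toReal
    (by
      intro φ
      change ‖(memLp_integral μ hK φ).toLp _‖ ≤ _
      rw [Lp.norm_toLp, Lp.norm_def, ← ENNReal.toReal_mul]
      exact ENNReal.toReal_mono (ENNReal.mul_lt_top hK.2 (Lp.memLp φ).2).ne
        (eLpNorm_integral_le μ hK φ))

end IntegralOperator

/-! ### Kernels of a metric measure space

A metric measure space is a compact metric space `X` with a Borel probability measure `μ`. -/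

section Kernels

variable {X : Type*} [MetricSpace X]

/-- `K_A(x, s) = -d(x, s)² / 2`. -/
def kernelA (x s : X) : ℝ := -(1 / 2) * dist x s ^ 2

/-- `K_B`, the double centering of `K_A`. -/
def kernelB [MeasurableSpace X] (μ : Measure X) (x s : X) : ℝ :=
  kernelA x s - ∫ w, kernelA w s ∂μ - ∫ z, kernelA x z ∂μ + ∫ z, ∫ w, kernelA w z ∂μ ∂μ

variable [CompactSpace X] [MeasurableSpace X] [BorelSpace X]
variable (μ : Measure X) [IsProbabilityMeasure μ]

theorem continuous_kernelB : Continuous (fun p : X × X => kernelB μ p.1 p.2) := by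
  have hA : Continuous (fun p : X × X => kernelA p.1 p.2) := by
    unfold kernelA; fun_prop
  have h1 : Continuous (fun x : X => ∫ z, kernelA x z ∂μ) := by
    have := continuous_parametric_integral_of_continuous (μ := μ)
      (f := fun x z : X => kernelA x z) hA isCompact_univ
    simpa using this
  have h2 : (fun s : X => ∫ w, kernelA w s ∂μ) = fun x : X => ∫ z, kernelA x z ∂μ := by
    funext s; simp only [kernelA, dist_comm]
  unfold kernelB
  refine ((hA.sub ?_).sub (h1.comp continuous_fst)).add continuous_const
  have h3 : Continuous (fun s : X => ∫ w, kernelA w s ∂μ) := h2 ▸ h1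
  exact h3.comp continuous_snd

theorem memLp_kernelB : MemLp (fun p : X × X => kernelB μ p.1 p.2) 2 (μ.prod μ) :=
  (continuous_kernelB μ).memLp_of_hasCompactSupport (HasCompactSupport.of_compactSpace _)

/-- The operator `T_{K_B}` on `L²(X, μ)`. -/
def operatorB : Lp ℝ 2 μ →L[ℝ] Lp ℝ 2 μ := integralOperator μ (kernelB μ) (memLp_kernelB μ)

end Kernels

/-! ### Strain -/

section Strain

variable {X : Type*} [MetricSpace X] [MeasurableSpace X] (μ : Measure X)

/-- `∫∫ (K_B(x, s) - K(x, s))² dμ(x) dμ(s)`, with value `∞` if the integral diverges. -/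
def kernelStrain (K : X → X → ℝ) : ℝ≥0∞ :=
  ∫⁻ s, ∫⁻ x, ENNReal.ofReal ((kernelB μ x s - K x s) ^ 2) ∂μ ∂μ

/-- The centered inner product kernel of a map `f` into a Hilbert space,
`(x, s) ↦ ⟪f x - f̄, f s - f̄⟫`, where `f̄ = ∫ f dμ` is the mean of `f`.
(If `f` is not integrable there is no mean, and the convention `∫ f dμ = 0` leaves the
inner product kernel uncentered.) -/
def fittedKernel {E : Type*} [NormedAddCommGroup E] [InnerProductSpace ℝ E] (f : X → E)
    (x s : X) : ℝ :=
  ⟪f x - ∫ w, f w ∂μ, f s - ∫ w, f w ∂μ⟫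

/-- The strain of a map `f` into a Hilbert space. -/
def strain {E : Type*} [NormedAddCommGroup E] [InnerProductSpace ℝ E] (f : X → E) : ℝ≥0∞ :=
  kernelStrain μ (fittedKernel μ f)

end Strain

/-! ### The MDS embeddings -/

section Embedding

variable {X : Type*} [MetricSpace X] [CompactSpace X] [MeasurableSpace X] [BorelSpace X]

/-- `l` lists the positive eigenvalues of `T_{K_B}` in non-increasing order, repeated according to
multiplicity (followed by zeros if there are only finitely many), and the `φ i` with `0 < l i` are
corresponding orthonormal eigenfunctions.  Where `l i = 0` nothing is required of `φ i`, since
such a pair contributes only a zero coordinate to the MDS embedding. -/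
structure IsEigensystem (μ : Measure X) [IsProbabilityMeasure μ]
    (l : ℕ → ℝ) (φ : ℕ → Lp ℝ 2 μ) : Prop where
  nonneg : ∀ i, 0 ≤ l i
  antitone : Antitone l
  orthonormal : Orthonormal ℝ (fun i : {i : ℕ // 0 < l i} => φ i)
  span_eq_eigenspace : ∀ c : ℝ, 0 < c →
    Submodule.span ℝ (φ '' {i | l i = c}) =
      Module.End.eigenspace (operatorB μ : Lp ℝ 2 μ →ₗ[ℝ] Lp ℝ 2 μ) c

/-- The MDS embedding into `ℝ^m`: `x ↦ (√(l i) φ_i(x))_{i < m}`. -/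
def mdsEmbedding {μ : Measure X} (l : ℕ → ℝ) (φ : ℕ → Lp ℝ 2 μ) (m : ℕ) (x : X) :
    EuclideanSpace ℝ (Fin m) :=
  WithLp.toLp 2 fun i : Fin m => √(l i) * φ i x

/-- `f` is the MDS embedding into `ℓ²`: `f(x) = (√(l i) φ_i(x))_{i ∈ ℕ}` for almost every `x`. -/
def IsMDSEmbedding {μ : Measure X} (l : ℕ → ℝ) (φ : ℕ → Lp ℝ 2 μ)
    (f : X → lp (fun _ : ℕ => ℝ) 2) : Prop :=
  ∀ᵐ x ∂μ, ∀ i, f x i = √(l i) * φ i x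

/-- `K` is the kernel `∑ i, l i φ_i(x) φ_i(s)`, as a series in `L²(X × X, μ ⊗ μ)`. -/
def IsSpectralKernel {μ : Measure X} (l : ℕ → ℝ) (φ : ℕ → Lp ℝ 2 μ) (K : X → X → ℝ) : Prop :=
  MemLp (fun p : X × X => K p.1 p.2) 2 (μ.prod μ) ∧
    Tendsto (fun n : ℕ => eLpNorm (fun p : X × X =>
      K p.1 p.2 - ∑ i ∈ Finset.range n, l i * φ i p.1 * φ i p.2) 2 (μ.prod μ)) atTop (𝓝 0)

end Embedding

end InfiniteMDS

end

/-!
The strain of a kernel `K` is the squared `L²(μ ⊗ μ)` norm of `K_B - K`, and Parseval's identity on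
almost every slice turns it into the squared Hilbert-Schmidt norm `∑ ‖(T_{K_B} - T_K) b_i‖²` in any
orthonormal basis `b` (`kernelStrain_eq_tsum`).  All optimality statements follow by evaluating
this sum in one well chosen basis.

Hilbert-Schmidt operators are compact, so the spectral theorem extends the eigenfunctions `φ_i`
with `l i > 0` to an orthonormal basis by eigenvectors `e_k` for eigenvalues `β_k ≤ 0`
(`exists_eigenbasis`).  The operator `A` of an inner product kernel is positive
(`inner_integralOperator_nonneg`), whence `‖β_k e_k - A e_k‖² ≥ β_k²` for every `k`.  So every map
into a Hilbert space has strain at least `∑ β_k²`, and this is the strain of the spectral kernel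
`∑ l i φ_i(x) φ_i(s)`.

For a map into `ℝ^m` the range of `A` lies in a space `V` of dimension at most `m`
(`exists_finrank_le_forall_integralOperator_mem`).  With `P` the orthogonal projection onto `V`,
`‖l_i φ_i - A φ_i‖² ≥ l_i² (1 - ‖P φ_i‖²)`, where `∑ ‖P φ_i‖² ≤ m` by Bessel's inequality.  Since
the `l_i` decrease, the sum of these bounds is smallest when the weight sits on the first `m`
indices, which leaves the tail `∑_{i ≥ m} l_i²` (`tsum_tail_le_of_finrank_le`).  That is what the
truncated kernel attains, and it tends to zero, so the strain of the spectral kernel is the infimum.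

The embeddings have mean zero because `T_{K_B}` annihilates constants; hence their centered inner
product kernels are the truncated kernels and, almost everywhere, the spectral kernel.
-/

namespace InfiniteMDS

universe u

/-! ### Hilbert-Schmidt operators, eigenbases and finite-rank approximation -/

section HilbertSpace

variable {H : Type*} [NormedAddCommGroup H] [InnerProductSpace ℝ H]

theorem countable_of_orthonormal [TopologicalSpace.SeparableSpace H] {ι : Type*} {v : ι → H}
    (hv : Orthonormal ℝ v) : Countable ι := by
  -- The balls of radius `1/2` around distinct members of an orthonormal family are disjoint.
  refine Pairwise.countable_of_isOpen_disjoint (s := fun i => Metric.ball (v i) (1 / 2)) ?_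
    (fun i => Metric.isOpen_ball) (fun i => ⟨v i, Metric.mem_ball_self (by norm_num)⟩)
  intro i j hij
  refine Metric.ball_disjoint_ball ?_
  have h : ‖v i - v j‖ ^ 2 = 2 := by
    rw [norm_sub_sq_real, hv.norm_eq_one, hv.norm_eq_one, hv.inner_eq_zero hij]; norm_num
  rw [dist_eq_norm]
  nlinarith [norm_nonneg (v i - v j)]

theorem enorm_sq_eq_ofReal {E : Type*} [SeminormedAddCommGroup E] (x : E) :
    ‖x‖ₑ ^ 2 = ENNReal.ofReal (‖x‖ ^ 2) := by
  rw [ENNReal.ofReal_pow (norm_nonneg x), ofReal_norm]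

theorem tsum_enorm_inner_sq [CompleteSpace H] {ι : Type*} (b : HilbertBasis ι ℝ H) (x : H) :
    ∑' i, ‖⟪b i, x⟫‖ₑ ^ 2 = ‖x‖ₑ ^ 2 := by
  have h := b.hasSum_inner_mul_inner x x
  rw [real_inner_self_eq_norm_sq] at h
  have h2 : ∀ i, ⟪x, b i⟫ * ⟪b i, x⟫ = ‖⟪b i, x⟫‖ ^ 2 := fun i => by
    rw [real_inner_comm, Real.norm_eq_abs, sq_abs, sq]
  simp only [h2] at h
  simp only [enorm_sq_eq_ofReal]
  rw [← h.tsum_eq, ENNReal.ofReal_tsum_of_nonneg (fun i => by positivity) h.summable]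

/-- Hilbert-Schmidt operators are compact: they are the sum, in operator norm, of the rank one
operators `x ↦ ⟪b i, x⟫ • A (b i)`. -/
theorem isCompactOperator_of_summable_norm_sq [CompleteSpace H] {ι : Type*}
    (b : HilbertBasis ι ℝ H) (A : H →L[ℝ] H) (hA : Summable fun i => ‖A (b i)‖ ^ 2) :
    IsCompactOperator A := by
  let F : ι → H →L[ℝ] H := fun i => (innerSL ℝ (b i)).smulRight (A (b i))
  have hF : ∀ i x, F i x = ⟪b i, x⟫ • A (b i) := fun i x => rfl
  have hbound : ∀ t : Finset ι, ‖∑ i ∈ t, F i‖ ≤ √(∑ i ∈ t, ‖A (b i)‖ ^ 2) := by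
    intro t
    refine ContinuousLinearMap.opNorm_le_bound _ (Real.sqrt_nonneg _) fun x => ?_
    rw [sum_apply]
    calc ‖∑ i ∈ t, F i x‖ ≤ ∑ i ∈ t, ‖A (b i)‖ * ‖⟪b i, x⟫‖ := by
          refine (norm_sum_le _ _).trans (Finset.sum_le_sum fun i _ => ?_)
          rw [hF, norm_smul, mul_comm]
      _ ≤ √(∑ i ∈ t, ‖A (b i)‖ ^ 2) * √(∑ i ∈ t, ‖⟪b i, x⟫‖ ^ 2) :=
          Real.sum_mul_le_sqrt_mul_sqrt _ _ _
      _ ≤ √(∑ i ∈ t, ‖A (b i)‖ ^ 2) * ‖x‖ := by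
          gcongr
          exact Real.sqrt_le_iff.2 ⟨norm_nonneg _, b.orthonormal.sum_inner_products_le x⟩
  have hsum : Summable F := by
    rw [summable_iff_vanishing_norm]
    intro ε hε
    obtain ⟨s, hs⟩ := summable_iff_vanishing_norm.1 hA (ε ^ 2) (by positivity)
    refine ⟨s, fun t ht => (hbound t).trans_lt ?_⟩
    rw [Real.sqrt_lt' hε]
    exact (le_abs_self _).trans_lt (hs t ht)
  have hlim : HasSum F A := by
    convert hsum.hasSum
    refine ContinuousLinearMap.ext fun x => ?_
    have h1 : HasSum (fun i => F i x) ((∑' i, F i) x) :=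
      hsum.hasSum.mapL (ContinuousLinearMap.apply ℝ H x)
    have h2 : HasSum (fun i => F i x) (A x) := by
      simpa [hF, HilbertBasis.repr_apply_apply] using (b.hasSum_repr x).mapL A
    exact h2.unique h1
  refine isCompactOperator_of_tendsto hlim (Eventually.of_forall fun s => ?_)
  refine (compactOperator (RingHom.id ℝ) H H).sum_mem fun i _ => ?_
  exact (isCompactOperator_of_locallyCompactSpace_rng
    (ContinuousLinearMap.toSpanSingleton ℝ (A (b i)))).comp_clm (innerSL ℝ (b i))

/-- An orthonormal system that spans the eigenspaces of a compact self-adjoint operator for its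
positive eigenvalues is extended to an orthonormal basis by eigenvectors for eigenvalues `≤ 0`. -/
theorem exists_eigenbasis {H : Type u} [NormedAddCommGroup H] [InnerProductSpace ℝ H]
    [CompleteSpace H] {T : H →L[ℝ] H} (hc : IsCompactOperator T)
    (hs : (T : H →ₗ[ℝ] H).IsSymmetric) {l : ℕ → ℝ} {φ : ℕ → H}
    (horth : Orthonormal ℝ (fun i : {i : ℕ // 0 < l i} => φ i))
    (hspan : ∀ c : ℝ, 0 < c → Submodule.span ℝ (φ '' {i | l i = c}) =
      Module.End.eigenspace (T : H →ₗ[ℝ] H) c) :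
    ∃ (κ : Type u) (e : HilbertBasis ({i : ℕ // 0 < l i} ⊕ κ) ℝ H) (β : κ → ℝ),
      (∀ i, e (Sum.inl i) = φ i) ∧ (∀ k, T (e (Sum.inr k)) = β k • e (Sum.inr k)) ∧
      ∀ k, β k ≤ 0 := by
  have hcomplete : ∀ c : ℝ, CompleteSpace (Module.End.eigenspace (T : H →ₗ[ℝ] H) c) := by
    intro c
    have h : IsClosed (Module.End.eigenspace (T : H →ₗ[ℝ] H) c : Set H) := by
      have : (Module.End.eigenspace (T : H →ₗ[ℝ] H) c : Set H) = {x | T x = c • x} := by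
        ext x; simp
      rw [this]
      exact isClosed_eq T.continuous (continuous_const_smul c)
    exact h.completeSpace_coe
  -- The new basis vectors come from orthonormal bases of the eigenspaces for eigenvalues `≤ 0`.
  choose w d hd using fun c : ℝ =>
    exists_hilbertBasis ℝ (Module.End.eigenspace (T : H →ₗ[ℝ] H) c)
  let κ := Σ c : {c : ℝ // c ≤ 0}, w c
  let u : κ → H := fun k => ((d k.1 k.2 : Module.End.eigenspace (T : H →ₗ[ℝ] H) (k.1 : ℝ)) : H)
  have hu : Orthonormal ℝ u :=
    (hs.orthogonalFamily_eigenspaces.comp Subtype.val_injective).orthonormal_sigma_orthonormal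
      (fun c : {c : ℝ // c ≤ 0} => (d c).orthonormal)
  have hueig : ∀ k : κ, T (u k) = (k.1 : ℝ) • u k := fun k =>
    Module.End.mem_eigenspace_iff.1 (d k.1 k.2).2
  have hφeig : ∀ i : {i : ℕ // 0 < l i}, T (φ i) = l i • φ i := fun i => by
    have : φ i ∈ Module.End.eigenspace (T : H →ₗ[ℝ] H) (l i) := by
      rw [← hspan _ i.2]
      exact Submodule.subset_span ⟨i, rfl, rfl⟩
    exact Module.End.mem_eigenspace_iff.1 this
  have hφu : ∀ (i : {i : ℕ // 0 < l i}) (k : κ), ⟪φ i, u k⟫ = 0 := fun i k => by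
    have h : ⟪T (φ i), u k⟫ = ⟪φ i, T (u k)⟫ := hs _ _
    rw [hφeig, hueig, real_inner_smul_left, real_inner_smul_right] at h
    have h1 : (l i - (k.1 : ℝ)) * ⟪φ i, u k⟫ = 0 := by rw [sub_mul, h, sub_self]
    have h2 : (0 : ℝ) < l i := i.2
    have h3 : (k.1 : ℝ) ≤ 0 := k.1.2
    exact (mul_eq_zero.1 h1).resolve_left (by linarith)
  let v : {i : ℕ // 0 < l i} ⊕ κ → H := Sum.elim (fun i => φ i) u
  have hv : Orthonormal ℝ v := by
    refine ⟨?_, ?_⟩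
    · rintro (i | k)
      exacts [horth.norm_eq_one i, hu.norm_eq_one k]
    · rintro (i | k) (j | k') hne
      · exact horth.inner_eq_zero fun h => hne (by rw [h])
      · exact hφu i k'
      · exact (real_inner_comm _ _).trans (hφu j k)
      · exact hu.inner_eq_zero fun h => hne (by rw [h])
  have hv_top : (Submodule.span ℝ (Set.range v))ᗮ = ⊥ := by
    rw [eq_bot_iff, ← ContinuousLinearMap.orthogonalComplement_iSup_eigenspaces_eq_bot hc hs,
      ← Submodule.iInf_orthogonal, le_iInf_iff]
    intro c x hx
    have hx : ∀ k, ⟪v k, x⟫ = 0 := fun k =>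
      (Submodule.mem_orthogonal _ x).1 hx _ (Submodule.subset_span ⟨k, rfl⟩)
    rcases lt_or_ge 0 c with hc0 | hc0
    · rw [← hspan c hc0, Submodule.mem_orthogonal]
      intro y hy
      induction hy using Submodule.span_induction with
      | mem y hy =>
        obtain ⟨i, hi, rfl⟩ := hy
        exact hx (Sum.inl ⟨i, by rw [Set.mem_ofPred_eq] at hi; rwa [hi]⟩)
      | zero => exact inner_zero_left _
      | add y z _ _ h1 h2 => rw [inner_add_left, h1, h2, add_zero]
      | smul a y _ h1 => rw [real_inner_smul_left, h1, mul_zero]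
    · rw [Submodule.mem_orthogonal]
      intro y hy
      have h := ((d c).hasSum_repr ⟨y, hy⟩).mapL
        ((innerSL ℝ x).comp (Module.End.eigenspace (T : H →ₗ[ℝ] H) c).subtypeL)
      have h0 : ∀ k : w c, ⟪x, ((d c k : Module.End.eigenspace (T : H →ₗ[ℝ] H) c) : H)⟫ = 0 :=
        fun k => (real_inner_comm _ _).trans (hx (Sum.inr ⟨⟨c, hc0⟩, k⟩))
      have h1 : HasSum (fun _ : w c => (0 : ℝ)) ⟪x, y⟫ := by simpa [h0] using h
      rw [real_inner_comm]
      exact h1.unique hasSum_zero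
  refine ⟨κ, HilbertBasis.mkOfOrthogonalEqBot hv hv_top, fun k => (k.1 : ℝ), ?_, ?_, ?_⟩
  · intro i; rw [HilbertBasis.coe_mkOfOrthogonalEqBot]
    rfl
  · intro k; rw [HilbertBasis.coe_mkOfOrthogonalEqBot]
    exact hueig k
  · exact fun k => k.1.2

/-- A sum of `l i ^ 2` with weights `w i ∈ [0, 1]` of total mass at most `m` is at most the sum of
the `m` largest terms; here `F` is a finite set of the remaining indices. -/
theorem sum_sq_le_sum_sq_mul_one_sub {l : ℕ → ℝ} (hl0 : ∀ i, 0 ≤ l i) (hl : Antitone l) (m : ℕ)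
    (F : Finset ℕ) (hF : ∀ i ∈ F, m ≤ i) {w : ℕ → ℝ} (hw0 : ∀ i ∈ F, 0 ≤ w i)
    (hw1 : ∀ i < m, w i ≤ 1) (hw : ∑ i ∈ Finset.range m ∪ F, w i ≤ m) :
    ∑ i ∈ F, l i ^ 2 ≤ ∑ i ∈ Finset.range m ∪ F, l i ^ 2 * (1 - w i) := by
  have hdisj : Disjoint (Finset.range m) F :=
    Finset.disjoint_left.2 fun i hi hi' => absurd (hF i hi') (by simpa using hi)
  rw [Finset.sum_union hdisj] at hw ⊢
  -- The threshold `l m ^ 2` separates the terms over `F` from those below `m`.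
  have h1 : ∑ i ∈ F, l i ^ 2 * w i ≤ l m ^ 2 * ∑ i ∈ F, w i := by
    rw [Finset.mul_sum]
    exact Finset.sum_le_sum fun i hi => mul_le_mul_of_nonneg_right
      (pow_le_pow_left₀ (hl0 i) (hl (hF i hi)) 2) (hw0 i hi)
  have h2 : l m ^ 2 * ∑ i ∈ Finset.range m, (1 - w i) ≤
      ∑ i ∈ Finset.range m, l i ^ 2 * (1 - w i) := by
    rw [Finset.mul_sum]
    refine Finset.sum_le_sum fun i hi => ?_
    have hi := Finset.mem_range.1 hi
    exact mul_le_mul_of_nonneg_right (pow_le_pow_left₀ (hl0 m) (hl hi.le) 2)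
      (sub_nonneg.2 (hw1 i hi))
  have h3 : ∑ i ∈ F, w i ≤ ∑ i ∈ Finset.range m, (1 - w i) := by
    simp only [Finset.sum_sub_distrib, Finset.sum_const, Finset.card_range, nsmul_eq_mul, mul_one]
    linarith
  have h4 := mul_le_mul_of_nonneg_left h3 (sq_nonneg (l m))
  simp only [mul_sub, mul_one, Finset.sum_sub_distrib] at h2 h4 ⊢
  linarith

theorem sum_norm_sq_starProjection_le {ι : Type*} {v : ι → H} (hv : Orthonormal ℝ v)
    (V : Submodule ℝ H) [FiniteDimensional ℝ V] (F : Finset ι) :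
    ∑ i ∈ F, ‖V.starProjection (v i)‖ ^ 2 ≤ Module.finrank ℝ V := by
  let ψ := stdOrthonormalBasis ℝ V
  have h1 : ∀ i, ‖V.starProjection (v i)‖ ^ 2 = ∑ j, ‖⟪v i, (ψ j : H)⟫‖ ^ 2 := fun i => by
    rw [Submodule.starProjection_apply, Submodule.norm_coe, ← ψ.sum_sq_norm_inner_right]
    refine Finset.sum_congr rfl fun j _ => ?_
    rw [Submodule.inner_orthogonalProjectionOnto_eq_of_mem_left, real_inner_comm]
  simp only [h1]
  rw [Finset.sum_comm]
  calc ∑ j, ∑ i ∈ F, ‖⟪v i, (ψ j : H)⟫‖ ^ 2 ≤ ∑ j, ‖(ψ j : H)‖ ^ 2 :=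
        Finset.sum_le_sum fun j _ => hv.sum_inner_products_le _
    _ = Module.finrank ℝ V := by
        have : ∀ j, ‖(ψ j : H)‖ = 1 := fun j => ψ.orthonormal.norm_eq_one j
        simp [this]

/-- A vector of `V` cannot approximate `c • y` better than the projection of `c • y` does. -/
theorem sq_mul_one_sub_le_norm_sub_sq (V : Submodule ℝ H) [FiniteDimensional ℝ V] {a y : H}
    (ha : a ∈ V) (hy : ‖y‖ = 1) (c : ℝ) :
    c ^ 2 * (1 - ‖V.starProjection y‖ ^ 2) ≤ ‖c • y - a‖ ^ 2 := by
  have h1 := V.norm_sq_eq_add_norm_sq_starProjection y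
  have h2 := V.norm_sq_eq_add_norm_sq_starProjection (c • y - a)
  have h3 : Vᗮ.starProjection a = 0 :=
    Submodule.starProjection_orthogonal_apply_eq_zero ha
  rw [map_sub, map_sub, h3, map_smul _ c, sub_zero, map_smul,
    norm_smul (α := ℝ) c (Vᗮ.starProjection y), mul_pow, Real.norm_eq_abs, sq_abs] at h2
  rw [hy] at h1
  have h4 : 1 - ‖V.starProjection y‖ ^ 2 = ‖Vᗮ.starProjection y‖ ^ 2 := by linarith
  rw [h4, h2]
  exact le_add_of_nonneg_left (sq_nonneg _)

/-- The part of the Eckart-Young bound that comes from the positive eigenvalues: on the span of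
the `φ i`, an operator with range in a space of dimension at most `m` misses the diagonal operator
with entries `l i` by at least the tail of the eigenvalues. -/
theorem tsum_tail_le_of_finrank_le {l : ℕ → ℝ} (hl0 : ∀ i, 0 ≤ l i) (hl : Antitone l) {φ : ℕ → H}
    (horth : Orthonormal ℝ (fun i : {i : ℕ // 0 < l i} => φ i)) {m : ℕ} (V : Submodule ℝ H)
    [FiniteDimensional ℝ V] (hV : Module.finrank ℝ V ≤ m) {A : H → H} (hA : ∀ x, A x ∈ V) :
    ∑' k, ‖l (k + m)‖ₑ ^ 2 ≤ ∑' i : {i : ℕ // 0 < l i}, ‖l i • φ i - A (φ i)‖ₑ ^ 2 := by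
  -- If `l m = 0` the tail vanishes; otherwise the indices below `m` all belong to the orthonormal
  -- system, as the weight inequality requires.
  rcases (hl0 m).eq_or_lt with hm | hm
  · have h0 : ∀ k, l (k + m) = 0 := fun k =>
      le_antisymm ((hl (Nat.le_add_left m k)).trans_eq hm.symm) (hl0 _)
    simp [h0]
  rw [ENNReal.tsum_eq_iSup_sum]
  refine iSup_le fun G => ?_
  let F : Finset ℕ := (G.map (addRightEmbedding m)).filter fun i => 0 < l i
  have hF : ∀ i ∈ F, m ≤ i ∧ 0 < l i := fun i hi => by
    obtain ⟨h1, h2⟩ := Finset.mem_filter.1 hi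
    obtain ⟨k, -, rfl⟩ := Finset.mem_map.1 h1
    exact ⟨Nat.le_add_left m k, h2⟩
  have hpos : ∀ i ∈ Finset.range m ∪ F, 0 < l i := fun i hi => by
    rcases Finset.mem_union.1 hi with h | h
    exacts [hm.trans_le (hl (Finset.mem_range.1 h).le), (hF i h).2]
  have hsum : ∀ f : ℕ → ℝ, ∑ i ∈ (Finset.range m ∪ F).subtype (fun i => 0 < l i), f i =
      ∑ i ∈ Finset.range m ∪ F, f i := fun f =>
    Finset.sum_subtype_of_mem f hpos
  have hw : ∑ i ∈ Finset.range m ∪ F, ‖V.starProjection (φ i)‖ ^ 2 ≤ m := by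
    rw [← hsum]
    exact (sum_norm_sq_starProjection_le horth V _).trans (Nat.cast_le.2 hV)
  have hnorm : ∀ i, 0 < l i → ‖φ i‖ = 1 := fun i hi => horth.norm_eq_one ⟨i, hi⟩
  have key := sum_sq_le_sum_sq_mul_one_sub hl0 hl m F (fun i hi => (hF i hi).1)
    (w := fun i => ‖V.starProjection (φ i)‖ ^ 2) (fun i _ => sq_nonneg _)
    (fun i hi => by
      have h := V.norm_starProjection_apply_le (φ i)
      rw [hnorm i (hm.trans_le (hl hi.le))] at h
      exact pow_le_one₀ (norm_nonneg _) h) hw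
  calc ∑ k ∈ G, ‖l (k + m)‖ₑ ^ 2 = ∑ i ∈ G.map (addRightEmbedding m), ‖l i‖ₑ ^ 2 := by
        simp
    _ = ∑ i ∈ F, ‖l i‖ₑ ^ 2 := by
        refine (Finset.sum_filter_of_ne fun i _ hi => (hl0 i).lt_of_ne fun h => hi ?_).symm
        rw [← h]; simp
    _ = ENNReal.ofReal (∑ i ∈ F, l i ^ 2) := by
        rw [ENNReal.ofReal_sum_of_nonneg fun i _ => sq_nonneg _]
        simp only [enorm_sq_eq_ofReal, Real.norm_eq_abs, sq_abs]
    _ ≤ ENNReal.ofReal (∑ i ∈ Finset.range m ∪ F, ‖l i • φ i - A (φ i)‖ ^ 2) :=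
        ENNReal.ofReal_le_ofReal (key.trans (Finset.sum_le_sum fun i hi =>
          sq_mul_one_sub_le_norm_sub_sq V (hA _) (hnorm i (hpos i hi)) _))
    _ = ∑ i ∈ (Finset.range m ∪ F).subtype (fun i => 0 < l i), ‖l i • φ i - A (φ i)‖ₑ ^ 2 := by
        rw [← hsum, ENNReal.ofReal_sum_of_nonneg fun i _ => sq_nonneg _]
        simp only [enorm_sq_eq_ofReal]
    _ ≤ _ := ENNReal.sum_le_tsum _

/-- Subtracting a positive operator does not reduce the Hilbert-Schmidt contribution of an
eigenvector for a nonpositive eigenvalue. -/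
theorem enorm_eigenvalue_le_of_inner_nonneg {y a : H} (hy : ‖y‖ = 1) (ha : 0 ≤ ⟪y, a⟫) {β : ℝ}
    (hβ : β ≤ 0) : ‖β‖ₑ ^ 2 ≤ ‖β • y - a‖ₑ ^ 2 := by
  simp only [enorm_sq_eq_ofReal]
  refine ENNReal.ofReal_le_ofReal ?_
  rw [norm_sub_sq_real, norm_smul, hy, mul_one, real_inner_smul_left]
  nlinarith [sq_nonneg ‖a‖, mul_nonneg (neg_nonneg.2 hβ) ha]

section SplitBasis

variable {ι κ : Type*} {e : HilbertBasis (ι ⊕ κ) ℝ H} {β : κ → ℝ}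

theorem inner_inl_inr_eq_zero (i : ι) (k : κ) : ⟪e (Sum.inl i), e (Sum.inr k)⟫ = 0 :=
  e.orthonormal.inner_eq_zero (by simp)

theorem enorm_smul_basis_sq (k : κ) : ‖β k • e (Sum.inr k)‖ₑ ^ 2 = ‖β k‖ₑ ^ 2 := by
  rw [enorm_smul, e.orthonormal.enorm_eq_one, mul_one]

theorem tsum_enorm_sq_le_of_nonneg (hβ0 : ∀ k, β k ≤ 0) {A : H → H} (hA : ∀ ψ, 0 ≤ ⟪ψ, A ψ⟫) :
    ∑' k, ‖β k‖ₑ ^ 2 ≤ ∑' k, ‖β k • e (Sum.inr k) - A (e (Sum.inr k))‖ₑ ^ 2 :=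
  ENNReal.tsum_le_tsum fun k => enorm_eigenvalue_le_of_inner_nonneg
    (e.orthonormal.norm_eq_one _) (hA _) (hβ0 k)

end SplitBasis

end HilbertSpace

/-! ### Integral operators with square integrable kernels -/

section KernelOperators

variable {X : Type*} [MeasurableSpace X] {μ : Measure X} [IsProbabilityMeasure μ]

theorem inner_eq_mul (a b : ℝ) : ⟪a, b⟫ = a * b := by
  simp [mul_comm]

theorem integralOperator_coeFn {K : X → X → ℝ}
    (hK : MemLp (fun p : X × X => K p.1 p.2) 2 (μ.prod μ)) (φ : Lp ℝ 2 μ) :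
    integralOperator μ K hK φ =ᵐ[μ] fun x => ∫ s, K x s * φ s ∂μ :=
  (memLp_integral μ hK φ).coeFn_toLp

theorem norm_integralOperator_le {K : X → X → ℝ}
    (hK : MemLp (fun p : X × X => K p.1 p.2) 2 (μ.prod μ)) :
    ‖integralOperator μ K hK‖ ≤ (eLpNorm (fun p : X × X => K p.1 p.2) 2 (μ.prod μ)).toReal :=
  LinearMap.mkContinuous_norm_le _ ENNReal.toReal_nonneg _

theorem integralOperator_sub {K L : X → X → ℝ}
    (hK : MemLp (fun p : X × X => K p.1 p.2) 2 (μ.prod μ))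
    (hL : MemLp (fun p : X × X => L p.1 p.2) 2 (μ.prod μ)) :
    integralOperator μ K hK - integralOperator μ L hL =
      integralOperator μ (fun x s => K x s - L x s) (hK.sub hL) := by
  refine ContinuousLinearMap.ext fun φ => Lp.ext ?_
  rw [sub_apply]
  filter_upwards [Lp.coeFn_sub (integralOperator μ K hK φ) (integralOperator μ L hL φ),
    integralOperator_coeFn hK φ, integralOperator_coeFn hL φ,
    integralOperator_coeFn (K := fun x s => K x s - L x s) (hK.sub hL) φ,
    (integrable_kernel_mul μ hK φ).prod_right_ae,
    (integrable_kernel_mul μ hL φ).prod_right_ae] with x h1 h2 h3 h4 h5 h6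
  rw [h1, Pi.sub_apply, h2, h3, ← integral_sub h5 h6]
  refine Eq.trans ?_ h4.symm
  simp only [sub_mul]

theorem integralOperator_congr {K L : X → X → ℝ}
    (hK : MemLp (fun p : X × X => K p.1 p.2) 2 (μ.prod μ))
    (hL : MemLp (fun p : X × X => L p.1 p.2) 2 (μ.prod μ))
    (h : (fun p : X × X => K p.1 p.2) =ᵐ[μ.prod μ] fun p => L p.1 p.2) :
    integralOperator μ K hK = integralOperator μ L hL := by
  rw [← sub_eq_zero, integralOperator_sub, ← norm_le_zero_iff]
  refine (norm_integralOperator_le _).trans_eq ?_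
  rw [eLpNorm_congr_ae (g := 0), eLpNorm_zero, ENNReal.toReal_zero]
  filter_upwards [h] with p hp
  simp [hp]

theorem memLp_tensor {X : Type*} [MeasurableSpace X] {μ : Measure X} [SFinite μ] (φ ψ : Lp ℝ 2 μ) :
    MemLp (fun p : X × X => φ p.1 * ψ p.2) 2 (μ.prod μ) := by
  refine (memLp_two_iff_integrable_sq
    ((Lp.memLp φ).1.comp_fst.mul (Lp.memLp ψ).1.comp_snd)).2 ?_
  refine ((Lp.memLp φ).integrable_sq.mul_prod (Lp.memLp ψ).integrable_sq).congr
    (Eventually.of_forall fun p => ?_)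
  simp only [Pi.mul_apply, mul_pow]

theorem integrable_kernel_mul_mul {K : X → X → ℝ}
    (hK : MemLp (fun p : X × X => K p.1 p.2) 2 (μ.prod μ)) (φ ψ : Lp ℝ 2 μ) :
    Integrable (fun p : X × X => K p.1 p.2 * (φ p.1 * ψ p.2)) (μ.prod μ) :=
  MemLp.integrable_mul (p := 2) (q := 2) hK (memLp_tensor φ ψ)

theorem inner_integralOperator {K : X → X → ℝ}
    (hK : MemLp (fun p : X × X => K p.1 p.2) 2 (μ.prod μ)) (φ ψ : Lp ℝ 2 μ) :
    ⟪φ, integralOperator μ K hK ψ⟫ = ∫ p, K p.1 p.2 * (φ p.1 * ψ p.2) ∂(μ.prod μ) := by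
  rw [integral_prod _ (integrable_kernel_mul_mul hK φ ψ), L2.inner_def]
  refine integral_congr_ae ?_
  filter_upwards [integralOperator_coeFn hK ψ] with x hx
  rw [hx, inner_eq_mul, ← integral_const_mul]
  exact integral_congr_ae (Eventually.of_forall fun s => by ring)

theorem isSymmetric_integralOperator {K : X → X → ℝ}
    (hK : MemLp (fun p : X × X => K p.1 p.2) 2 (μ.prod μ))
    (hsymm : ∀ᵐ p ∂(μ.prod μ), K p.1 p.2 = K p.2 p.1) :
    (integralOperator μ K hK : Lp ℝ 2 μ →ₗ[ℝ] Lp ℝ 2 μ).IsSymmetric := by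
  intro φ ψ
  change ⟪integralOperator μ K hK φ, ψ⟫ = ⟪φ, integralOperator μ K hK ψ⟫
  rw [real_inner_comm, inner_integralOperator, inner_integralOperator, ← integral_prod_swap]
  refine integral_congr_ae ?_
  filter_upwards [hsymm] with p hp
  simp only [Prod.fst_swap, Prod.snd_swap, hp]
  ring

theorem memLp_kernel_slice {K : X → X → ℝ}
    (hK : MemLp (fun p : X × X => K p.1 p.2) 2 (μ.prod μ)) :
    ∀ᵐ x ∂μ, MemLp (K x) 2 μ := by
  filter_upwards [hK.1.prodMk_left, hK.integrable_sq.prod_right_ae] with x h1 h2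
  exact (memLp_two_iff_integrable_sq h1).2 h2

theorem enorm_sq_eq_lintegral {Y : Type*} [MeasurableSpace Y] {ν : Measure Y} (f : Lp ℝ 2 ν) :
    ‖f‖ₑ ^ 2 = ∫⁻ y, ‖f y‖ₑ ^ 2 ∂ν := by
  rw [Lp.enorm_def, eLpNorm_eq_lintegral_rpow_enorm_toReal (by norm_num) (by norm_num),
    ← ENNReal.rpow_natCast, ← ENNReal.rpow_mul]
  norm_num

/-- The squared Hilbert-Schmidt norm of an integral operator, in any countable orthonormal basis,
is the squared `L²` norm of its kernel: apply Parseval's identity to almost every slice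
`K x`. -/
theorem tsum_enorm_integralOperator_sq {K : X → X → ℝ}
    (hK : MemLp (fun p : X × X => K p.1 p.2) 2 (μ.prod μ)) {ι : Type*} [Countable ι]
    (b : HilbertBasis ι ℝ (Lp ℝ 2 μ)) :
    ∑' i, ‖integralOperator μ K hK (b i)‖ₑ ^ 2 = ∫⁻ p, ‖K p.1 p.2‖ₑ ^ 2 ∂(μ.prod μ) := by
  simp only [enorm_sq_eq_lintegral]
  rw [← lintegral_tsum fun i => (Lp.memLp _).1.enorm.pow_const 2,
    lintegral_prod _ (hK.1.enorm.pow_const 2)]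
  refine lintegral_congr_ae ?_
  filter_upwards [memLp_kernel_slice hK,
    ae_all_iff.2 fun i => integralOperator_coeFn hK (b i)] with x hx hT
  have h1 : ∀ i, integralOperator μ K hK (b i) x = ⟪b i, hx.toLp⟫ := fun i => by
    rw [hT i, L2.inner_def]
    refine integral_congr_ae ?_
    filter_upwards [hx.coeFn_toLp] with s hs
    rw [hs, inner_eq_mul, mul_comm]
  simp only [h1]
  rw [tsum_enorm_inner_sq, enorm_sq_eq_lintegral]
  refine lintegral_congr_ae ?_
  filter_upwards [hx.coeFn_toLp] with s hs
  rw [hs]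

theorem integralOperator_finset_sum {ι : Type*} (F : Finset ι) (c : ι → ℝ) (a : ι → Lp ℝ 2 μ)
    (hK : MemLp (fun p : X × X => ∑ j ∈ F, c j * a j p.1 * a j p.2) 2 (μ.prod μ))
    (ψ : Lp ℝ 2 μ) :
    integralOperator μ (fun x s => ∑ j ∈ F, c j * a j x * a j s) hK ψ =
      ∑ j ∈ F, (c j * ⟪a j, ψ⟫) • a j := by
  refine Lp.ext ?_
  have hint : ∀ j, Integrable (fun s => a j s * ψ s) μ := fun j =>
    MemLp.integrable_mul (p := 2) (q := 2) (Lp.memLp _) (Lp.memLp _)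
  have hsum := Lp.coeFn_finsetSum F fun j => (c j * ⟪a j, ψ⟫) • a j
  have hsmul : ∀ᵐ x ∂μ, ∀ j ∈ F, ((c j * ⟪a j, ψ⟫) • a j) x = (c j * ⟪a j, ψ⟫) * a j x :=
    (Finset.eventually_all F).2 fun j _ => Lp.coeFn_smul _ _
  filter_upwards [integralOperator_coeFn
    (K := fun x s => ∑ j ∈ F, c j * a j x * a j s) hK ψ, hsum, hsmul] with x h1 h2 h3
  rw [h1, h2, Finset.sum_apply]
  calc ∫ s, (∑ j ∈ F, c j * a j x * a j s) * ψ s ∂μ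
      = ∫ s, ∑ j ∈ F, c j * a j x * (a j s * ψ s) ∂μ := by
        simp only [Finset.sum_mul, mul_assoc]
    _ = ∑ j ∈ F, c j * a j x * ∫ s, a j s * ψ s ∂μ := by
        rw [integral_finsetSum _ fun j _ => (hint j).const_mul _]
        simp only [integral_const_mul]
    _ = _ := by
        refine Finset.sum_congr rfl fun j hj => ?_
        rw [h3 j hj, L2.inner_def]
        simp only [inner_eq_mul]
        ring

theorem aestronglyMeasurable_inner_kernel {X : Type*} [MeasurableSpace X] {μ : Measure X}
    [SFinite μ] {E : Type*} [NormedAddCommGroup E]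
    [InnerProductSpace ℝ E] {h : X → E} (hh : AEStronglyMeasurable h μ) :
    AEStronglyMeasurable (fun p : X × X => ⟪h p.1, h p.2⟫) (μ.prod μ) :=
  hh.comp_fst.inner hh.comp_snd

/-- An inner product kernel in `L²` has a positive operator, even if `h` itself is not square
integrable: on the sets where `‖h‖ ≤ N` the quadratic form is `‖∫ φ • h‖ ^ 2`, and these exhaust
the space. -/
theorem inner_integralOperator_nonneg {E : Type*} [NormedAddCommGroup E]
    [InnerProductSpace ℝ E] [CompleteSpace E] {h : X → E} (hh : AEStronglyMeasurable h μ)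
    (hK : MemLp (fun p : X × X => ⟪h p.1, h p.2⟫) 2 (μ.prod μ)) (φ : Lp ℝ 2 μ) :
    0 ≤ ⟪φ, integralOperator μ (fun x s => ⟪h x, h s⟫) hK φ⟫ := by
  rw [inner_integralOperator]
  have hG := integrable_kernel_mul_mul (K := fun x s => ⟪h x, h s⟫) hK φ φ
  set g := hh.mk h with hg
  have hgm : StronglyMeasurable g := hh.stronglyMeasurable_mk
  let S : ℕ → Set X := fun N => {x | ‖g x‖ ≤ N}
  have hS : ∀ N, MeasurableSet (S N) := fun N =>
    measurableSet_le hgm.norm.measurable measurable_const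
  have hSmono : Monotone S := fun N M hNM x (hx : ‖g x‖ ≤ N) =>
    hx.trans (Nat.cast_le.2 hNM)
  have hSU : (⋃ N, S N ×ˢ S N) = Set.univ := by
    refine Set.eq_univ_of_forall fun p => Set.mem_iUnion.2 ?_
    obtain ⟨N, hN⟩ := exists_nat_ge (max ‖g p.1‖ ‖g p.2‖)
    exact ⟨N, (le_max_left _ _).trans hN, (le_max_right _ _).trans hN⟩
  have hlim := tendsto_setIntegral_of_monotone (μ := μ.prod μ)
    (f := fun p : X × X => ⟪h p.1, h p.2⟫ * (φ p.1 * φ p.2))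
    (s := fun N => S N ×ˢ S N) (fun N => (hS N).prod (hS N))
    (fun N M hNM => Set.prod_mono (hSmono hNM) (hSmono hNM)) hG.integrableOn
  rw [hSU, setIntegral_univ] at hlim
  refine ge_of_tendsto' hlim fun N => ?_
  have hφg : Integrable (fun x => φ x • h x) (μ.restrict (S N)) := by
    refine Integrable.mono' (g := fun x => N * ‖φ x‖)
      ((((Lp.memLp φ).integrable (by norm_num)).norm.const_mul _).restrict)
      ((Lp.memLp φ).1.smul hh).restrict ?_
    refine (ae_restrict_iff' (hS N)).2 ?_
    filter_upwards [hh.ae_eq_mk] with x hx hxS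
    rw [norm_smul, mul_comm, hx]
    exact mul_le_mul_of_nonneg_right hxS (norm_nonneg _)
  have hG' := hG.integrableOn (s := S N ×ˢ S N)
  rw [IntegrableOn, ← Measure.prod_restrict] at hG'
  rw [← Measure.prod_restrict, integral_prod _ hG']
  have h1 : ∀ x, ∫ s, ⟪h x, h s⟫ * (φ x * φ s) ∂(μ.restrict (S N)) =
      ⟪∫ s, φ s • h s ∂(μ.restrict (S N)), φ x • h x⟫ := fun x => by
    rw [real_inner_comm, ← integral_inner hφg]
    refine integral_congr_ae (Eventually.of_forall fun s => ?_)
    simp only [real_inner_smul_left, real_inner_smul_right]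
    ring
  simp only [h1]
  rw [integral_inner hφg]
  exact real_inner_self_nonneg

/-- If the inner product kernel of a map into a finite-dimensional space is in `L²(μ ⊗ μ)`, then
the map is in `L²(μ)`: almost all its values lie in the subspace of those `a` for which
`⟪a, h ·⟫` is square integrable. -/
theorem memLp_of_memLp_inner_kernel {E : Type*} [NormedAddCommGroup E] [InnerProductSpace ℝ E]
    [FiniteDimensional ℝ E] {h : X → E}
    (hK : MemLp (fun p : X × X => ⟪h p.1, h p.2⟫) 2 (μ.prod μ)) : MemLp h 2 μ := by
  let U : Submodule ℝ E :=
    { carrier := {a | MemLp (fun s => ⟪a, h s⟫) 2 μ}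
      add_mem' := fun {a b} ha hb => by
        have := MemLp.add ha hb
        simpa only [Set.mem_ofPred_eq, inner_add_left] using! this
      zero_mem' := by simp
      smul_mem' := fun c a ha => by
        have := MemLp.const_mul ha c
        simpa only [Set.mem_ofPred_eq, real_inner_smul_left] using! this }
  have hU : ∀ᵐ x ∂μ, h x ∈ U := memLp_kernel_slice (K := fun x s => ⟪h x, h s⟫) hK
  let u := stdOrthonormalBasis ℝ U
  have hsum : MemLp (fun x => ∑ j, ⟪(u j : E), h x⟫ • (u j : E)) 2 μ :=
    memLp_finsetSum _ fun j _ =>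
      (ContinuousLinearMap.toSpanSingleton ℝ (u j : E)).comp_memLp' (u j).2
  refine hsum.ae_eq ?_
  filter_upwards [hU] with x hx
  have h1 := congrArg (Subtype.val : U → E) (u.sum_repr' ⟨h x, hx⟩)
  simpa using h1

/-- The operator of an inner product kernel in `L²` of a map into `ℝ^m` has rank at most `m`. -/
theorem exists_finrank_le_forall_integralOperator_mem {m : ℕ} {h : X → EuclideanSpace ℝ (Fin m)}
    (hK : MemLp (fun p : X × X => ⟪h p.1, h p.2⟫) 2 (μ.prod μ)) :
    ∃ V : Submodule ℝ (Lp ℝ 2 μ), FiniteDimensional ℝ V ∧ Module.finrank ℝ V ≤ m ∧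
      ∀ φ, integralOperator μ (fun x s => ⟪h x, h s⟫) hK φ ∈ V := by
  have hh := memLp_of_memLp_inner_kernel hK
  have hc : ∀ j : Fin m, MemLp (fun x => h x j) 2 μ := fun j =>
    (EuclideanSpace.proj (𝕜 := ℝ) (ι := Fin m) j).comp_memLp' hh
  let a : Fin m → Lp ℝ 2 μ := fun j => (hc j).toLp
  have ha : ∀ᵐ x ∂μ, ∀ j, a j x = h x j := ae_all_iff.2 fun j => (hc j).coeFn_toLp
  have hL : MemLp (fun p : X × X => ∑ j, (1 : ℝ) * a j p.1 * a j p.2) 2 (μ.prod μ) := by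
    refine memLp_finsetSum _ fun j _ => ?_
    simpa only [one_mul] using memLp_tensor (a j) (a j)
  have hKL : (fun p : X × X => ⟪h p.1, h p.2⟫) =ᵐ[μ.prod μ]
      fun p => ∑ j, (1 : ℝ) * a j p.1 * a j p.2 := by
    filter_upwards [Measure.quasiMeasurePreserving_fst.ae ha,
      Measure.quasiMeasurePreserving_snd.ae ha] with p h1 h2
    simp only [h1, h2, PiLp.inner_apply, inner_eq_mul, one_mul]
  refine ⟨Submodule.span ℝ (Set.range a), FiniteDimensional.span_of_finite ℝ (Set.finite_range a),
    (finrank_range_le_card a).trans_eq (Fintype.card_fin m), fun φ => ?_⟩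
  rw [integralOperator_congr (K := fun x s => ⟪h x, h s⟫)
    (L := fun x s => ∑ j, (1 : ℝ) * a j x * a j s) hK hL hKL,
    integralOperator_finset_sum Finset.univ (fun _ => 1) a hL]
  exact Submodule.sum_mem _ fun j _ =>
    Submodule.smul_mem _ _ (Submodule.subset_span ⟨j, rfl⟩)

end KernelOperators

/-! ### The strain as a Hilbert-Schmidt norm -/

section StrainFormula

variable {X : Type*} [MetricSpace X] [CompactSpace X] [MeasurableSpace X] [BorelSpace X]
variable {μ : Measure X} [IsProbabilityMeasure μ]

theorem kernelB_symm {X : Type*} [MetricSpace X] [MeasurableSpace X] (μ : Measure X) (x s : X) :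
    kernelB μ x s = kernelB μ s x := by
  simp only [kernelB, kernelA, dist_comm]
  simp only [dist_comm s]
  ring

theorem countable_hilbertBasis_index {ι : Type*} (b : HilbertBasis ι ℝ (Lp ℝ 2 μ)) :
    Countable ι :=
  have : Fact ((2 : ℝ≥0∞) ≠ ∞) := ⟨by norm_num⟩
  countable_of_orthonormal b.orthonormal

theorem aestronglyMeasurable_kernelB_sub {K : X → X → ℝ}
    (hK : AEStronglyMeasurable (fun p : X × X => K p.1 p.2) (μ.prod μ)) :
    AEStronglyMeasurable (fun p : X × X => kernelB μ p.1 p.2 - K p.1 p.2) (μ.prod μ) :=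
  (continuous_kernelB μ).aestronglyMeasurable.sub hK

theorem kernelStrain_eq_lintegral_prod {K : X → X → ℝ}
    (hK : AEStronglyMeasurable (fun p : X × X => K p.1 p.2) (μ.prod μ)) :
    kernelStrain μ K = ∫⁻ p, ‖kernelB μ p.1 p.2 - K p.1 p.2‖ₑ ^ 2 ∂(μ.prod μ) := by
  rw [lintegral_prod_symm _ ((aestronglyMeasurable_kernelB_sub hK).enorm.pow_const 2)]
  simp only [kernelStrain, enorm_sq_eq_ofReal, Real.norm_eq_abs, sq_abs]

theorem kernelStrain_congr {K L : X → X → ℝ}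
    (hL : AEStronglyMeasurable (fun p : X × X => L p.1 p.2) (μ.prod μ))
    (h : (fun p : X × X => K p.1 p.2) =ᵐ[μ.prod μ] fun p => L p.1 p.2) :
    kernelStrain μ K = kernelStrain μ L := by
  rw [kernelStrain_eq_lintegral_prod hL, kernelStrain_eq_lintegral_prod (hL.congr h.symm)]
  refine lintegral_congr_ae ?_
  filter_upwards [h] with p hp
  rw [hp]

theorem memLp_of_kernelStrain_ne_top {K : X → X → ℝ}
    (hK : AEStronglyMeasurable (fun p : X × X => K p.1 p.2) (μ.prod μ))
    (h : kernelStrain μ K ≠ ∞) : MemLp (fun p : X × X => K p.1 p.2) 2 (μ.prod μ) := by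
  rw [kernelStrain_eq_lintegral_prod hK] at h
  have hsub : MemLp (fun p : X × X => kernelB μ p.1 p.2 - K p.1 p.2) 2 (μ.prod μ) := by
    refine ⟨aestronglyMeasurable_kernelB_sub hK, ?_⟩
    rw [eLpNorm_lt_top_iff_lintegral_rpow_enorm_lt_top (by norm_num) (by norm_num)]
    simpa using h.lt_top
  refine ((memLp_kernelB μ).sub hsub).ae_eq (Eventually.of_forall fun p => ?_)
  simp

/-- The strain is the squared Hilbert-Schmidt norm of `T_{K_B} - T_K`. -/
theorem kernelStrain_eq_tsum {K : X → X → ℝ}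
    (hK : MemLp (fun p : X × X => K p.1 p.2) 2 (μ.prod μ)) {ι : Type*}
    (b : HilbertBasis ι ℝ (Lp ℝ 2 μ)) :
    kernelStrain μ K = ∑' i, ‖(operatorB μ - integralOperator μ K hK) (b i)‖ₑ ^ 2 := by
  have := countable_hilbertBasis_index b
  rw [kernelStrain_eq_lintegral_prod hK.1, operatorB, integralOperator_sub,
    tsum_enorm_integralOperator_sq]

theorem kernelStrain_ne_top {K : X → X → ℝ}
    (hK : MemLp (fun p : X × X => K p.1 p.2) 2 (μ.prod μ)) : kernelStrain μ K ≠ ∞ := by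
  rw [kernelStrain_eq_lintegral_prod hK.1]
  have h := ((memLp_kernelB μ).sub hK).2
  rw [eLpNorm_lt_top_iff_lintegral_rpow_enorm_lt_top (by norm_num) (by norm_num)] at h
  simpa using h.ne

theorem isSymmetric_operatorB : (operatorB μ : Lp ℝ 2 μ →ₗ[ℝ] Lp ℝ 2 μ).IsSymmetric :=
  isSymmetric_integralOperator _ (Eventually.of_forall fun p => kernelB_symm μ p.1 p.2)

theorem summable_norm_operatorB_sq {ι : Type*} (b : HilbertBasis ι ℝ (Lp ℝ 2 μ)) :
    Summable fun i => ‖operatorB μ (b i)‖ ^ 2 := by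
  have := countable_hilbertBasis_index b
  have h : ∑' i, ‖operatorB μ (b i)‖ₑ ^ 2 ≠ ∞ := by
    rw [operatorB, tsum_enorm_integralOperator_sq]
    have h := (memLp_kernelB μ).2
    rw [eLpNorm_lt_top_iff_lintegral_rpow_enorm_lt_top (by norm_num) (by norm_num)] at h
    simpa using h.ne
  simpa using ENNReal.summable_toReal h

theorem isCompactOperator_operatorB : IsCompactOperator (operatorB μ) := by
  obtain ⟨w, b, -⟩ := exists_hilbertBasis ℝ (Lp ℝ 2 μ)
  exact isCompactOperator_of_summable_norm_sq b _ (summable_norm_operatorB_sq b)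

theorem hasSum_inner_eq_kernelStrain {K : X → X → ℝ}
    (hK : MemLp (fun p : X × X => K p.1 p.2) 2 (μ.prod μ))
    (hsymm : ∀ᵐ p ∂(μ.prod μ), K p.1 p.2 = K p.2 p.1) {ι : Type*}
    (b : HilbertBasis ι ℝ (Lp ℝ 2 μ)) :
    HasSum (fun i => ⟪b i, (operatorB μ - integralOperator μ K hK)
      ((operatorB μ - integralOperator μ K hK) (b i))⟫) (kernelStrain μ K).toReal := by
  have hne := kernelStrain_ne_top hK
  rw [kernelStrain_eq_tsum hK b] at hne ⊢
  have hS : ∀ φ ψ, ⟪φ, (operatorB μ - integralOperator μ K hK) ψ⟫ =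
      ⟪(operatorB μ - integralOperator μ K hK) φ, ψ⟫ := fun φ ψ =>
    ((isSymmetric_operatorB.sub (isSymmetric_integralOperator hK hsymm)) φ ψ).symm
  have h1 : ∀ i, ⟪b i, (operatorB μ - integralOperator μ K hK)
      ((operatorB μ - integralOperator μ K hK) (b i))⟫ =
      (‖(operatorB μ - integralOperator μ K hK) (b i)‖ₑ ^ 2).toReal := fun i => by
    rw [hS, real_inner_self_eq_norm_sq, ENNReal.toReal_pow, toReal_enorm]
  simp only [h1]
  rw [ENNReal.tsum_toReal_eq (ENNReal.ne_top_of_tsum_ne_top hne)]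
  exact ENNReal.hasSum_toReal hne

/-- Double centering makes the integral of `K_B` over either variable vanish. -/
theorem integral_kernelB_left (x : X) : ∫ s, kernelB μ x s ∂μ = 0 := by
  have hA : Continuous (fun p : X × X => kernelA p.1 p.2) := by unfold kernelA; fun_prop
  have h1 : Continuous (fun s : X => ∫ w, kernelA w s ∂μ) := by
    simpa using continuous_parametric_integral_of_continuous (μ := μ)
      (f := fun s w : X => kernelA w s) (hA.comp continuous_swap) isCompact_univ
  have hi : ∀ {f : X → ℝ}, Continuous f → Integrable f μ := fun hf =>
    hf.integrable_of_hasCompactSupport (HasCompactSupport.of_compactSpace _)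
  have hAx : Integrable (fun s => kernelA x s) μ :=
    hi (hA.comp (continuous_const.prodMk continuous_id))
  unfold kernelB
  rw [integral_add, integral_sub, integral_sub hAx (hi h1)]
  · simp
  · exact hAx.sub (hi h1)
  · exact integrable_const _
  · exact (hAx.sub (hi h1)).sub (integrable_const _)
  · exact integrable_const _

end StrainFormula

/-! ### Truncated and spectral kernels of an eigensystem -/

section Eigensystem

variable {X : Type u} [MetricSpace X] [CompactSpace X] [MeasurableSpace X] [BorelSpace X]
variable {μ : Measure X} [IsProbabilityMeasure μ] {l : ℕ → ℝ} {φ : ℕ → Lp ℝ 2 μ}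

theorem IsEigensystem.operatorB_apply (hφ : IsEigensystem μ l φ) {i : ℕ} (hi : 0 < l i) :
    operatorB μ (φ i) = l i • φ i := by
  have : φ i ∈ Module.End.eigenspace (operatorB μ : Lp ℝ 2 μ →ₗ[ℝ] Lp ℝ 2 μ) (l i) := by
    rw [← hφ.span_eq_eigenspace _ hi]
    exact Submodule.subset_span ⟨i, rfl, rfl⟩
  exact Module.End.mem_eigenspace_iff.1 this

/-- Eigenfunctions for nonzero eigenvalues have mean zero, since `T_{K_B}` annihilates the
constants. -/
theorem IsEigensystem.integral_eq_zero (hφ : IsEigensystem μ l φ) {i : ℕ} (hi : 0 < l i) :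
    ∫ x, φ i x ∂μ = 0 := by
  let one : Lp ℝ 2 μ := (memLp_const (1 : ℝ)).toLp
  have hone : one =ᵐ[μ] fun _ => (1 : ℝ) := (memLp_const (1 : ℝ)).coeFn_toLp
  have hinner : ∀ ψ : Lp ℝ 2 μ, ⟪ψ, one⟫ = ∫ x, ψ x ∂μ := fun ψ => by
    rw [L2.inner_def]
    refine integral_congr_ae ?_
    filter_upwards [hone] with x hx
    rw [hx, inner_eq_mul, mul_one]
  have hT : operatorB μ one = 0 := by
    refine Lp.ext ?_
    filter_upwards [integralOperator_coeFn (memLp_kernelB μ) one, Lp.coeFn_zero ℝ 2 μ] with x h1 h2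
    rw [h2, operatorB, h1, Pi.zero_apply, ← integral_kernelB_left (μ := μ) x]
    refine integral_congr_ae ?_
    filter_upwards [hone] with s hs
    rw [hs, mul_one]
  have h : ⟪operatorB μ (φ i), one⟫ = ⟪φ i, operatorB μ one⟫ :=
    isSymmetric_operatorB (μ := μ) _ _
  rw [hφ.operatorB_apply hi, hT, inner_zero_right, real_inner_smul_left, hinner] at h
  exact (mul_eq_zero.1 h).resolve_left hi.ne'

theorem IsEigensystem.sqrt_mul_integral_eq_zero (hφ : IsEigensystem μ l φ) (i : ℕ) :
    √(l i) * ∫ x, φ i x ∂μ = 0 := by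
  rcases (hφ.nonneg i).eq_or_lt with h | h
  · rw [← h, Real.sqrt_zero, zero_mul]
  · rw [hφ.integral_eq_zero h, mul_zero]

/-- The kernel `∑ i < n, l i φ_i(x) φ_i(s)`. -/
noncomputable def truncatedKernel (l : ℕ → ℝ) (φ : ℕ → Lp ℝ 2 μ) (n : ℕ) (x s : X) : ℝ :=
  ∑ i ∈ Finset.range n, l i * φ i x * φ i s

theorem memLp_truncatedKernel (l : ℕ → ℝ) (φ : ℕ → Lp ℝ 2 μ) (n : ℕ) :
    MemLp (fun p : X × X => truncatedKernel l φ n p.1 p.2) 2 (μ.prod μ) := by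
  refine memLp_finsetSum _ fun i _ => ?_
  simpa only [mul_assoc] using (memLp_tensor (φ i) (φ i)).const_mul (l i)

theorem integralOperator_truncatedKernel (n : ℕ) (ψ : Lp ℝ 2 μ) :
    integralOperator μ (truncatedKernel l φ n) (memLp_truncatedKernel l φ n) ψ =
      ∑ i ∈ Finset.range n, (l i * ⟪φ i, ψ⟫) • φ i :=
  integralOperator_finset_sum (Finset.range n) l φ (memLp_truncatedKernel l φ n) ψ

theorem IsEigensystem.integralOperator_truncatedKernel_self (hφ : IsEigensystem μ l φ) (n : ℕ)
    {j : ℕ} (hj : 0 < l j) :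
    integralOperator μ (truncatedKernel l φ n) (memLp_truncatedKernel l φ n) (φ j) =
      if j < n then l j • φ j else 0 := by
  rw [integralOperator_truncatedKernel]
  have h : ∀ i, (l i * ⟪φ i, φ j⟫) • φ i = if i = j then l j • φ j else 0 := fun i => by
    split_ifs with hij
    · rw [hij, real_inner_self_eq_norm_sq, hφ.orthonormal.norm_eq_one ⟨j, hj⟩, one_pow, mul_one]
    · rcases (hφ.nonneg i).eq_or_lt with h0 | h0
      · rw [← h0, zero_mul, zero_smul]
      · have h1 : ⟪φ i, φ j⟫ = 0 := hφ.orthonormal.inner_eq_zero (i := ⟨i, h0⟩) (j := ⟨j, hj⟩)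
          fun h => hij (Subtype.ext_iff.1 h)
        rw [h1, mul_zero, zero_smul]
  simp only [h, Finset.sum_ite_eq', Finset.mem_range]

theorem IsEigensystem.integralOperator_truncatedKernel_of_orthogonal (hφ : IsEigensystem μ l φ)
    (n : ℕ) {ψ : Lp ℝ 2 μ} (hψ : ∀ i, 0 < l i → ⟪φ i, ψ⟫ = 0) :
    integralOperator μ (truncatedKernel l φ n) (memLp_truncatedKernel l φ n) ψ = 0 := by
  rw [integralOperator_truncatedKernel]
  refine Finset.sum_eq_zero fun i _ => ?_
  rcases (hφ.nonneg i).eq_or_lt with h0 | h0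
  · rw [← h0, zero_mul, zero_smul]
  · rw [hψ i h0, mul_zero, zero_smul]

theorem IsSpectralKernel.tendsto_integralOperator {K : X → X → ℝ} (hK : IsSpectralKernel l φ K)
    (ψ : Lp ℝ 2 μ) :
    Tendsto (fun n => integralOperator μ (truncatedKernel l φ n) (memLp_truncatedKernel l φ n) ψ)
      atTop (𝓝 (integralOperator μ K hK.1 ψ)) := by
  have h : Tendsto (fun n =>
      integralOperator μ (truncatedKernel l φ n) (memLp_truncatedKernel l φ n))
      atTop (𝓝 (integralOperator μ K hK.1)) := by
    rw [tendsto_iff_norm_sub_tendsto_zero]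
    have h0 := (ENNReal.tendsto_toReal ENNReal.zero_ne_top).comp hK.2
    refine squeeze_zero (fun n => norm_nonneg _) (fun n => ?_) h0
    rw [norm_sub_rev, integralOperator_sub]
    exact norm_integralOperator_le _
  exact ((ContinuousLinearMap.apply ℝ (Lp ℝ 2 μ) ψ).continuous.tendsto _).comp h

theorem IsEigensystem.exists_eigenbasis (hφ : IsEigensystem μ l φ) :
    ∃ (κ : Type u) (e : HilbertBasis ({i : ℕ // 0 < l i} ⊕ κ) ℝ (Lp ℝ 2 μ)) (β : κ → ℝ),
      (∀ i, e (Sum.inl i) = φ i) ∧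
      (∀ k, operatorB μ (e (Sum.inr k)) = β k • e (Sum.inr k)) ∧ ∀ k, β k ≤ 0 :=
  InfiniteMDS.exists_eigenbasis isCompactOperator_operatorB isSymmetric_operatorB hφ.orthonormal
    hφ.span_eq_eigenspace

theorem IsEigensystem.summable_sq (hφ : IsEigensystem μ l φ) :
    Summable fun i : {i : ℕ // 0 < l i} => l i ^ 2 := by
  obtain ⟨κ, e, β, he, -, -⟩ := hφ.exists_eigenbasis
  have h := (summable_norm_operatorB_sq e).comp_injective Sum.inl_injective
  refine h.congr fun i => ?_
  rw [Function.comp_apply, he, hφ.operatorB_apply i.2, norm_smul,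
    hφ.orthonormal.norm_eq_one i, mul_one, Real.norm_eq_abs, sq_abs]

/-- The series `∑ i, l i φ_i(x) φ_i(s)` converges in `L²(μ ⊗ μ)`, because the functions
`φ_i(x) φ_i(s)` are orthonormal there and the squares of the eigenvalues are summable. -/
theorem IsEigensystem.exists_isSpectralKernel (hφ : IsEigensystem μ l φ) :
    ∃ K : X → X → ℝ, IsSpectralKernel l φ K := by
  let t : ℕ → Lp ℝ 2 (μ.prod μ) := fun i => (memLp_tensor (φ i) (φ i)).toLp
  have ht : ∀ i, t i =ᵐ[μ.prod μ] fun p => φ i p.1 * φ i p.2 := fun i =>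
    (memLp_tensor (φ i) (φ i)).coeFn_toLp
  have hinner : ∀ i j, ⟪t i, t j⟫ = ⟪φ i, φ j⟫ * ⟪φ i, φ j⟫ := fun i j => by
    simp only [L2.inner_def, inner_eq_mul]
    rw [← integral_prod_mul]
    refine integral_congr_ae ?_
    filter_upwards [ht i, ht j] with p h1 h2
    rw [h1, h2]
    ring
  have horth : Orthonormal ℝ (fun i : {i : ℕ // 0 < l i} => t i) := by
    classical
    rw [orthonormal_iff_ite]
    intro i j
    rw [hinner, orthonormal_iff_ite.1 hφ.orthonormal i j]
    split_ifs <;> simp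
  have hsum : Summable fun i => l i • t i := by
    have h1 : Summable fun i : {i : ℕ // 0 < l i} => l i • t i := by
      have h2 := (horth.orthogonalFamily.summable_iff_norm_sq_summable
        (fun i : {i : ℕ // 0 < l i} => l i)).2
        (hφ.summable_sq.congr fun i => by rw [Real.norm_eq_abs, sq_abs])
      simpa using! h2
    obtain ⟨a, ha⟩ := h1
    -- The terms with `l i = 0` vanish, whatever `φ i` is.
    refine ⟨a, (hasSum_subtype_iff_of_support_subset fun i hi => ?_).1 ha⟩
    exact (hφ.nonneg i).lt_of_ne fun h0 => hi (by
      change l i • t i = 0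
      rw [← h0, zero_smul])
  refine ⟨fun x s => (∑' i, l i • t i : Lp ℝ 2 (μ.prod μ)) (x, s), Lp.memLp _, ?_⟩
  have hlim := tendsto_iff_norm_sub_tendsto_zero.1 hsum.hasSum.tendsto_sum_nat
  have hlim' := ENNReal.tendsto_ofReal hlim
  rw [ENNReal.ofReal_zero] at hlim'
  refine hlim'.congr fun n => ?_
  rw [norm_sub_rev, ofReal_norm, Lp.enorm_def]
  refine eLpNorm_congr_ae ?_
  have hsmul : ∀ᵐ p ∂(μ.prod μ), ∀ i, (l i • t i) p = l i * t i p :=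
    ae_all_iff.2 fun i => Lp.coeFn_smul _ _
  filter_upwards [Lp.coeFn_sub (∑' i, l i • t i) (∑ i ∈ Finset.range n, l i • t i),
    Lp.coeFn_finsetSum (Finset.range n) fun i => l i • t i, hsmul, ae_all_iff.2 ht]
    with p h1 h2 h3 h4
  rw [h1, Pi.sub_apply, h2, Finset.sum_apply]
  simp only [h3, h4, mul_assoc]

end Eigensystem

/-! ### Lower bounds for the strain -/

section OptimalStrain

variable {X : Type u} [MetricSpace X] [CompactSpace X] [MeasurableSpace X] [BorelSpace X]
variable {μ : Measure X} [IsProbabilityMeasure μ] {l : ℕ → ℝ} {φ : ℕ → Lp ℝ 2 μ}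
variable {κ : Type u} {e : HilbertBasis ({i : ℕ // 0 < l i} ⊕ κ) ℝ (Lp ℝ 2 μ)} {β : κ → ℝ}

/-- The squared Hilbert-Schmidt norm, split over the eigenvectors for positive and for nonpositive
eigenvalues. -/
theorem IsEigensystem.kernelStrain_eq_add (hφ : IsEigensystem μ l φ)
    (he : ∀ i, e (Sum.inl i) = φ i)
    (hβ : ∀ k, operatorB μ (e (Sum.inr k)) = β k • e (Sum.inr k)) {K : X → X → ℝ}
    (hK : MemLp (fun p : X × X => K p.1 p.2) 2 (μ.prod μ)) :
    kernelStrain μ K =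
      ∑' i : {i : ℕ // 0 < l i}, ‖l i • φ i - integralOperator μ K hK (φ i)‖ₑ ^ 2 +
      ∑' k, ‖β k • e (Sum.inr k) - integralOperator μ K hK (e (Sum.inr k))‖ₑ ^ 2 := by
  rw [kernelStrain_eq_tsum hK e, Summable.tsum_sum ENNReal.summable ENNReal.summable]
  congr 1
  · refine tsum_congr fun i => ?_
    rw [he, sub_apply, hφ.operatorB_apply i.2]
  · refine tsum_congr fun k => ?_
    rw [sub_apply, hβ]

/-- Truncating at `m` leaves the tail of the positive eigenvalues and all other eigenvalues. -/
theorem IsEigensystem.kernelStrain_truncatedKernel (hφ : IsEigensystem μ l φ)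
    (he : ∀ i, e (Sum.inl i) = φ i)
    (hβ : ∀ k, operatorB μ (e (Sum.inr k)) = β k • e (Sum.inr k)) (m : ℕ) :
    kernelStrain μ (truncatedKernel l φ m) = ∑' k, ‖l (k + m)‖ₑ ^ 2 + ∑' k, ‖β k‖ₑ ^ 2 := by
  rw [hφ.kernelStrain_eq_add he hβ (memLp_truncatedKernel l φ m)]
  congr 1
  · let f : ℕ → ℝ≥0∞ := fun i => if i < m then 0 else ‖l i‖ₑ ^ 2
    have h1 : ∀ i : {i : ℕ // 0 < l i}, ‖l i • φ i - integralOperator μ (truncatedKernel l φ m)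
        (memLp_truncatedKernel l φ m) (φ i)‖ₑ ^ 2 = f i := fun i => by
      rw [hφ.integralOperator_truncatedKernel_self m i.2]
      simp only [f]
      split_ifs
      · simp
      · rw [sub_zero, enorm_smul, hφ.orthonormal.enorm_eq_one i, mul_one]
    have h2 : Function.support f ⊆ {i | 0 < l i} := fun i hi => by
      refine (hφ.nonneg i).lt_of_ne fun h0 => hi ?_
      simp [f, ← h0]
    have h3 : ∑ i ∈ Finset.range m, f i = 0 :=
      Finset.sum_eq_zero fun i hi => if_pos (Finset.mem_range.1 hi)
    rw [tsum_congr h1]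
    refine (tsum_subtype_eq_of_support_subset h2).trans ?_
    rw [← ENNReal.summable.sum_add_tsum_nat_add' (k := m), h3, zero_add]
    exact tsum_congr fun k => if_neg (by omega)
  · refine tsum_congr fun k => ?_
    rw [hφ.integralOperator_truncatedKernel_of_orthogonal m
      fun i hi => he ⟨i, hi⟩ ▸ inner_inl_inr_eq_zero _ k, sub_zero, enorm_smul_basis_sq]

theorem IsEigensystem.kernelStrain_spectralKernel (hφ : IsEigensystem μ l φ)
    (he : ∀ i, e (Sum.inl i) = φ i)
    (hβ : ∀ k, operatorB μ (e (Sum.inr k)) = β k • e (Sum.inr k)) {K : X → X → ℝ}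
    (hK : IsSpectralKernel l φ K) : kernelStrain μ K = ∑' k, ‖β k‖ₑ ^ 2 := by
  rw [hφ.kernelStrain_eq_add he hβ hK.1]
  have h1 : ∀ i : {i : ℕ // 0 < l i}, integralOperator μ K hK.1 (φ i) = l i • φ i := fun i => by
    refine tendsto_nhds_unique (hK.tendsto_integralOperator (φ i)) (tendsto_const_nhds.congr' ?_)
    filter_upwards [eventually_gt_atTop (i : ℕ)] with n hn
    rw [hφ.integralOperator_truncatedKernel_self n i.2, if_pos hn]
  have h2 : ∀ k, integralOperator μ K hK.1 (e (Sum.inr k)) = 0 := fun k => by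
    refine tendsto_nhds_unique (hK.tendsto_integralOperator _)
      (tendsto_const_nhds.congr fun n => ?_)
    rw [hφ.integralOperator_truncatedKernel_of_orthogonal n
      fun i hi => he ⟨i, hi⟩ ▸ inner_inl_inr_eq_zero _ k]
  simp only [h1, h2, sub_self, sub_zero, enorm_zero, enorm_smul_basis_sq]
  simp

/-- No map into a Hilbert space has a strain below the sum of the squares of the nonpositive
eigenvalues, because the operator of its centered inner product kernel is positive. -/
theorem IsEigensystem.tsum_le_strain (hφ : IsEigensystem μ l φ)
    (he : ∀ i, e (Sum.inl i) = φ i)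
    (hβ : ∀ k, operatorB μ (e (Sum.inr k)) = β k • e (Sum.inr k)) (hβ0 : ∀ k, β k ≤ 0)
    {E : Type*} [NormedAddCommGroup E] [InnerProductSpace ℝ E] [CompleteSpace E] {g : X → E}
    (hg : AEStronglyMeasurable g μ) : ∑' k, ‖β k‖ₑ ^ 2 ≤ strain μ g := by
  have hh : AEStronglyMeasurable (fun x => g x - ∫ w, g w ∂μ) μ :=
    hg.sub aestronglyMeasurable_const
  by_cases htop : strain μ g = ∞
  · rw [htop]; exact le_top
  have hK := memLp_of_kernelStrain_ne_top (aestronglyMeasurable_inner_kernel hh) htop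
  rw [strain, hφ.kernelStrain_eq_add he hβ hK]
  exact (tsum_enorm_sq_le_of_nonneg hβ0 (inner_integralOperator_nonneg hh hK)).trans le_add_self

/-- The Eckart-Young bound for the strain: a map into `ℝ^m` also misses the positive eigenvalues
beyond the first `m`. -/
theorem IsEigensystem.tsum_add_tsum_le_strain (hφ : IsEigensystem μ l φ)
    (he : ∀ i, e (Sum.inl i) = φ i)
    (hβ : ∀ k, operatorB μ (e (Sum.inr k)) = β k • e (Sum.inr k)) (hβ0 : ∀ k, β k ≤ 0)
    {m : ℕ} {g : X → EuclideanSpace ℝ (Fin m)} (hg : AEStronglyMeasurable g μ) :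
    ∑' k, ‖l (k + m)‖ₑ ^ 2 + ∑' k, ‖β k‖ₑ ^ 2 ≤ strain μ g := by
  have hh : AEStronglyMeasurable (fun x => g x - ∫ w, g w ∂μ) μ :=
    hg.sub aestronglyMeasurable_const
  by_cases htop : strain μ g = ∞
  · rw [htop]; exact le_top
  have hK := memLp_of_kernelStrain_ne_top (K := fittedKernel μ g)
    (aestronglyMeasurable_inner_kernel hh) htop
  obtain ⟨V, hV, hVm, hVmem⟩ := exists_finrank_le_forall_integralOperator_mem
    (h := fun x => g x - ∫ w, g w ∂μ) hK
  rw [strain, hφ.kernelStrain_eq_add he hβ hK]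
  have hpos := inner_integralOperator_nonneg (h := fun x => g x - ∫ w, g w ∂μ) hh hK
  change ∀ ψ, integralOperator μ (fittedKernel μ g) hK ψ ∈ V at hVmem
  change ∀ ψ, 0 ≤ ⟪ψ, integralOperator μ (fittedKernel μ g) hK ψ⟫ at hpos
  generalize integralOperator μ (fittedKernel μ g) hK = T at hVmem hpos ⊢
  exact add_le_add
    (tsum_tail_le_of_finrank_le hφ.nonneg hφ.antitone hφ.orthonormal V hVm (A := T) hVmem)
    (tsum_enorm_sq_le_of_nonneg hβ0 (A := T) hpos)

theorem IsEigensystem.tsum_enorm_sq_ne_top (hφ : IsEigensystem μ l φ) :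
    ∑' i, ‖l i‖ₑ ^ 2 ≠ ∞ := by
  obtain ⟨κ, e, β, he, hβ, -⟩ := hφ.exists_eigenbasis
  have h := hφ.kernelStrain_truncatedKernel he hβ 0
  have h0 := kernelStrain_ne_top (memLp_truncatedKernel l φ 0)
  rw [h] at h0
  simpa using (ENNReal.add_ne_top.1 h0).1

end OptimalStrain

/-! ### The strain of the MDS embeddings -/

section Embedding

variable {X : Type*} [MetricSpace X] [CompactSpace X] [MeasurableSpace X] [BorelSpace X]
variable {μ : Measure X} [IsProbabilityMeasure μ] {l : ℕ → ℝ} {φ : ℕ → Lp ℝ 2 μ}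

/-- The MDS coordinates along any orthonormal vectors have mean zero, so their centered inner
product kernel is the truncated kernel. -/
theorem IsEigensystem.fittedKernel_sum_smul (hφ : IsEigensystem μ l φ) {E : Type*}
    [NormedAddCommGroup E] [InnerProductSpace ℝ E] [CompleteSpace E] {m : ℕ} {u : Fin m → E}
    (hu : Orthonormal ℝ u) :
    fittedKernel μ (fun x => ∑ i : Fin m, (√(l i) * φ i x) • u i) = truncatedKernel l φ m := by
  have hmean : ∫ x, ∑ i : Fin m, (√(l i) * φ i x) • u i ∂μ = 0 := by
    have hint : ∀ i, Integrable (fun x => √(l i) * φ i x) μ := fun i =>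
      ((Lp.memLp (φ i)).integrable (by norm_num)).const_mul _
    rw [integral_finsetSum _ fun (i : Fin m) _ => (hint i).smul_const (u i)]
    simp only [integral_smul_const, integral_const_mul, hφ.sqrt_mul_integral_eq_zero, zero_smul,
      Finset.sum_const_zero]
  funext x s
  rw [fittedKernel, hmean, sub_zero, sub_zero, hu.inner_sum, truncatedKernel,
    Finset.sum_range]
  refine Finset.sum_congr rfl fun i _ => ?_
  rw [conj_trivial]
  linear_combination φ i x * φ i s * Real.mul_self_sqrt (hφ.nonneg i)

theorem mdsEmbedding_eq_sum_smul {X : Type*} [MeasurableSpace X] {μ : Measure X}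
    (l : ℕ → ℝ) (φ : ℕ → Lp ℝ 2 μ) (m : ℕ) :
    mdsEmbedding l φ m = fun x => ∑ i : Fin m, (√(l i) * φ i x) •
      EuclideanSpace.basisFun (Fin m) ℝ i := by
  funext x
  ext j
  simp [mdsEmbedding, Pi.single_apply]

theorem IsEigensystem.strain_mdsEmbedding (hφ : IsEigensystem μ l φ) (m : ℕ) :
    strain μ (mdsEmbedding l φ m) = kernelStrain μ (truncatedKernel l φ m) := by
  rw [strain, mdsEmbedding_eq_sum_smul,
    hφ.fittedKernel_sum_smul (EuclideanSpace.basisFun (Fin m) ℝ).orthonormal]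

theorem orthonormal_lp_single :
    Orthonormal ℝ (fun i : ℕ => (lp.single 2 i (1 : ℝ) : lp (fun _ : ℕ => ℝ) 2)) := by
  rw [orthonormal_iff_ite]
  intro i j
  rw [lp.inner_single_left, lp.single_apply, inner_eq_mul, one_mul, Pi.single_apply]

/-- The strain of the embedding into `ℝ^m` is attained by a map into `ℓ²`. -/
theorem IsEigensystem.exists_strain_eq (hφ : IsEigensystem μ l φ) (m : ℕ) :
    ∃ g : X → lp (fun _ : ℕ => ℝ) 2, AEStronglyMeasurable g μ ∧
      kernelStrain μ (truncatedKernel l φ m) = strain μ g := by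
  refine ⟨fun x => ∑ i : Fin m, (√(l i) * φ i x) •
    (lp.single 2 (i : ℕ) (1 : ℝ) : lp (fun _ : ℕ => ℝ) 2), ?_, ?_⟩
  · exact Finset.aestronglyMeasurable_fun_sum _ fun i _ =>
      ((Lp.memLp (φ i)).1.const_mul _).smul_const _
  · exact congrArg (kernelStrain μ)
      (hφ.fittedKernel_sum_smul (orthonormal_lp_single.comp _ Fin.val_injective)).symm

/-- The mean of the embedding vanishes coordinatewise; if the embedding is not integrable, the
integral is `0` by convention. -/
theorem IsMDSEmbedding.integral_eq_zero (hφ : IsEigensystem μ l φ)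
    {f : X → lp (fun _ : ℕ => ℝ) 2} (hf : IsMDSEmbedding l φ f) : ∫ x, f x ∂μ = 0 := by
  by_cases hint : Integrable f μ
  · ext i
    have h := (lp.evalCLM ℝ (fun _ : ℕ => ℝ) 2 i).integral_comp_comm hint
    have h2 : ∫ x, f x i ∂μ = 0 := by
      rw [integral_congr_ae (hf.mono fun x hx => hx i), integral_const_mul,
        hφ.sqrt_mul_integral_eq_zero]
    exact h.symm.trans h2
  · exact integral_undef hint

/-- The inner product in `ℓ²` is the pointwise limit of the truncated kernels, which converge to the
spectral kernel in `L²` and hence almost everywhere along a subsequence. -/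
theorem IsMDSEmbedding.fittedKernel_ae_eq (hφ : IsEigensystem μ l φ)
    {f : X → lp (fun _ : ℕ => ℝ) 2} (hf : IsMDSEmbedding l φ f) {K : X → X → ℝ}
    (hK : IsSpectralKernel l φ K) :
    (fun p : X × X => fittedKernel μ f p.1 p.2) =ᵐ[μ.prod μ] fun p => K p.1 p.2 := by
  have hmeas : TendstoInMeasure (μ.prod μ)
      (fun n (p : X × X) => truncatedKernel l φ n p.1 p.2) atTop (fun p => K p.1 p.2) := by
    refine tendstoInMeasure_of_tendsto_eLpNorm two_ne_zero
      (fun n => (memLp_truncatedKernel l φ n).1) hK.1.1 (hK.2.congr fun n => ?_)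
    exact eLpNorm_sub_comm _ _ _ _
  obtain ⟨ns, hns, hlim⟩ := hmeas.exists_seq_tendsto_ae
  filter_upwards [hlim, Measure.quasiMeasurePreserving_fst.ae hf,
    Measure.quasiMeasurePreserving_snd.ae hf] with p h h1 h2
  refine tendsto_nhds_unique ?_ h
  rw [fittedKernel, hf.integral_eq_zero hφ, sub_zero, sub_zero]
  refine ((lp.hasSum_inner (f p.1) (f p.2)).tendsto_sum_nat.comp hns.tendsto_atTop).congr
    fun n => Finset.sum_congr rfl fun i _ => ?_
  rw [h1, h2, inner_eq_mul]
  linear_combination φ i p.1 * φ i p.2 * Real.mul_self_sqrt (hφ.nonneg i)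

theorem IsMDSEmbedding.strain_eq (hφ : IsEigensystem μ l φ)
    {f : X → lp (fun _ : ℕ => ℝ) 2} (hf : IsMDSEmbedding l φ f) {K : X → X → ℝ}
    (hK : IsSpectralKernel l φ K) : strain μ f = kernelStrain μ K :=
  kernelStrain_congr hK.1.1 (hf.fittedKernel_ae_eq hφ hK)

/-- Since `∫ ∑ l i φ_i² = ∑ l i < ∞`, the series `∑ l i φ_i(x)²` is finite for almost every `x`. -/
theorem IsEigensystem.exists_isMDSEmbedding (hφ : IsEigensystem μ l φ) (hl : Summable l) :
    ∃ f : X → lp (fun _ : ℕ => ℝ) 2, IsMDSEmbedding l φ f := by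
  have hm : ∀ i, AEMeasurable (fun x => ‖√(l i) * φ i x‖ₑ ^ 2) μ := fun i =>
    ((Lp.memLp (φ i)).1.const_mul _).enorm.pow_const 2
  have hi : ∀ i, ∫⁻ x, ‖√(l i) * φ i x‖ₑ ^ 2 ∂μ ≤ ENNReal.ofReal (l i) := fun i => by
    simp only [enorm_mul, mul_pow]
    rw [lintegral_const_mul'' _ ((Lp.memLp (φ i)).1.enorm.pow_const 2), ← enorm_sq_eq_lintegral,
      enorm_sq_eq_ofReal (√(l i)), Real.norm_eq_abs, sq_abs, Real.sq_sqrt (hφ.nonneg i)]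
    rcases (hφ.nonneg i).eq_or_lt with h0 | h0
    · rw [← h0]; simp
    · rw [hφ.orthonormal.enorm_eq_one ⟨i, h0⟩, one_pow, mul_one]
  have hfin : ∫⁻ x, ∑' i, ‖√(l i) * φ i x‖ₑ ^ 2 ∂μ ≠ ∞ := by
    rw [lintegral_tsum hm]
    exact ne_top_of_le_ne_top hl.tsum_ofReal_ne_top (ENNReal.tsum_le_tsum hi)
  have hae : ∀ᵐ x ∂μ, Memℓp (fun i => √(l i) * φ i x) 2 := by
    filter_upwards [ae_lt_top' (AEMeasurable.tsum hm) hfin] with x hx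
    refine memℓp_gen ?_
    simpa using ENNReal.summable_toReal hx.ne
  classical
  refine ⟨fun x => if h : Memℓp (fun i => √(l i) * φ i x) 2 then ⟨_, h⟩ else 0, ?_⟩
  filter_upwards [hae] with x hx i
  rw [dif_pos hx]

theorem IsEigensystem.isGLB_strain (hφ : IsEigensystem μ l φ) {K : X → X → ℝ}
    (hK : IsSpectralKernel l φ K) :
    IsGLB {t | ∃ g : X → lp (fun _ : ℕ => ℝ) 2, AEStronglyMeasurable g μ ∧ t = strain μ g}
      (kernelStrain μ K) := by
  obtain ⟨κ, e, β, he, hβ, hβ0⟩ := hφ.exists_eigenbasis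
  rw [hφ.kernelStrain_spectralKernel he hβ hK]
  refine ⟨?_, fun t ht => ?_⟩
  · rintro t ⟨g, hg, rfl⟩
    exact hφ.tsum_le_strain he hβ hβ0 hg
  · have hlim := (ENNReal.tendsto_sum_nat_add _ hφ.tsum_enorm_sq_ne_top).add_const
      (∑' k, ‖β k‖ₑ ^ 2)
    rw [zero_add] at hlim
    refine ge_of_tendsto' hlim fun m => ?_
    rw [← hφ.kernelStrain_truncatedKernel he hβ m]
    exact ht (hφ.exists_strain_eq m)

end Embedding

end InfiniteMDS

theorem mainTheorem1 {X : Type*} [MetricSpace X] [CompactSpace X] [MeasurableSpace X]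
    [BorelSpace X] (μ : Measure X) [IsProbabilityMeasure μ]
    (l : ℕ → ℝ) (φ : ℕ → Lp ℝ 2 μ) (hφ : InfiniteMDS.IsEigensystem μ l φ) :
    -- the strain is the squared Hilbert-Schmidt norm, and the trace of the square, of the
    -- difference of the operators
    (∀ (K : X → X → ℝ) (hK : MemLp (fun p : X × X => K p.1 p.2) 2 (μ.prod μ)),
      (∀ᵐ p ∂(μ.prod μ), K p.1 p.2 = K p.2 p.1) →
      ∀ (ι : Type*) (b : HilbertBasis ι ℝ (Lp ℝ 2 μ)),
        InfiniteMDS.kernelStrain μ K =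
          ∑' i, ‖(InfiniteMDS.operatorB μ - InfiniteMDS.integralOperator μ K hK) (b i)‖ₑ ^ 2 ∧
        HasSum (fun i => ⟪b i, (InfiniteMDS.operatorB μ - InfiniteMDS.integralOperator μ K hK)
            ((InfiniteMDS.operatorB μ - InfiniteMDS.integralOperator μ K hK) (b i))⟫)
          (InfiniteMDS.kernelStrain μ K).toReal) ∧
    -- optimality among maps into `ℝ^m`
    (∀ (m : ℕ) (g : X → EuclideanSpace ℝ (Fin m)), AEStronglyMeasurable g μ →
      InfiniteMDS.strain μ (InfiniteMDS.mdsEmbedding l φ m) ≤ InfiniteMDS.strain μ g) ∧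
    -- optimality among maps into `ℓ²`
    (∀ f : X → lp (fun _ : ℕ => ℝ) 2, InfiniteMDS.IsMDSEmbedding l φ f →
      ∀ g : X → lp (fun _ : ℕ => ℝ) 2, AEStronglyMeasurable g μ →
        InfiniteMDS.strain μ f ≤ InfiniteMDS.strain μ g) ∧
    -- the MDS embedding takes values in `ℓ²` if the eigenvalues that are kept are summable
    (Summable l → ∃ f : X → lp (fun _ : ℕ => ℝ) 2, InfiniteMDS.IsMDSEmbedding l φ f) ∧
    -- the kernel of the MDS embedding always attains the infimum of the strain
    (∃ K : X → X → ℝ, InfiniteMDS.IsSpectralKernel l φ K ∧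
      IsGLB {t | ∃ g : X → lp (fun _ : ℕ => ℝ) 2, AEStronglyMeasurable g μ ∧
        t = InfiniteMDS.strain μ g} (InfiniteMDS.kernelStrain μ K) ∧
      ∀ f : X → lp (fun _ : ℕ => ℝ) 2, InfiniteMDS.IsMDSEmbedding l φ f →
        (fun p : X × X => InfiniteMDS.fittedKernel μ f p.1 p.2) =ᵐ[μ.prod μ]
          fun p => K p.1 p.2) := by

  refine ⟨fun K hK hsymm ι b => ⟨InfiniteMDS.kernelStrain_eq_tsum hK b,
    InfiniteMDS.hasSum_inner_eq_kernelStrain hK hsymm b⟩, fun m g hg => ?_, fun f hf g hg => ?_,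
    hφ.exists_isMDSEmbedding, ?_⟩
  · obtain ⟨κ, e, β, he, hβ, hβ0⟩ := hφ.exists_eigenbasis
    rw [hφ.strain_mdsEmbedding, hφ.kernelStrain_truncatedKernel he hβ]
    exact hφ.tsum_add_tsum_le_strain he hβ hβ0 hg
  · obtain ⟨K, hK⟩ := hφ.exists_isSpectralKernel
    rw [hf.strain_eq hφ hK]
    exact (hφ.isGLB_strain hK).1 ⟨g, hg, rfl⟩
  · obtain ⟨K, hK⟩ := hφ.exists_isSpectralKernel
    exact ⟨K, hK, hφ.isGLB_strain hK, fun f hf => hf.fittedKernel_ae_eq hφ hK⟩
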